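/- Let $m\ge 0$ and let $(P_0,\dots,P_m)$ be a symmetric Clifford system on a nonzero finite-dimensional real inner product space $V$, that is, symmetric endomorphisms of $V$ with $P_iP_j+P_jP_i=2\delta_{ij}\,\mathrm{Id}$. Let $\mathcal P=\mathrm{span}\{P_0,\dots,P_m\}$ and $$U^+(\mathcal P)=\{U\in O(V): PU=UP\text{ for all }P\in\mathcal P\}.$$ Let $\mathrm{Cl}^*_{m+1}$ be the real algebra generated by $E_0,\dots,E_m$ subject to $E_iE_j+E_jE_i=2\delta_{ij}$; then $V$ is a $\mathrm{Cl}^*_{m+1}$-module via $E_i\mapsto P_i$. Let $\mathfrak d$ be any irreducible real $\mathrm{Cl}^*_{m+1}$-module. (a) If $m\not\equiv 0\pmod 4$, there is a positive integer $k$ such that $V\cong\bigoplus_{i=1}^k\mathfrak d$ as $\mathrm{Cl}^*_{m+1}$-modules, and $U^+(\mathcal P)$ is isomorphic, as a topological group, to $$O(k)\ \text{ if } m\equiv 1,7\ (\mathrm{mod}\ 8),\qquad U(k)\ \text{ if } m\equiv 2,6\ (\mathrm{mod}\ 8),\qquad Sp(k)\ \text{ if } m\equiv 3,5\ (\mathrm{mod}\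 8).$$ (b) If $m\equiv 0\pmod 4$, put $\mathfrak d_+=\mathfrak d$ and let $\mathfrak d_-$ be $\mathfrak d$ with the action twisted by the automorphism of $\mathrm{Cl}^*_{m+1}$ that sends each $E_i$ to $-E_i$. Then $\mathfrak d_-$ is irreducible and not isomorphic to $\mathfrak d_+$, and there are integers $k_+,k_-\ge 0$ with $k_++k_->0$ such that $V\cong\big(\bigoplus_{i=1}^{k_+}\mathfrak d_+\big)\oplus\big(\bigoplus_{i=1}^{k_-}\mathfrak d_-\big)$ as $\mathrm{Cl}^*_{m+1}$-modules, and $U^+(\mathcal P)$ is isomorphic, as a topological group, to $$O(k_+)\times O(k_-)\ \text{ if } m\equiv 0\ (\mathrm{mod}\ 8),\qquad Sp(k_+)\times Sp(k_-)\ \text{ if } m\equiv 4\ (\mathrm{mod}\ 8).$$ Here $Sp(k)$ is the compact symplectic group of quaternionic $k\times k$ matrices $A$ with $A^*A=AA^*=1$. -/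

import Mathlib

open scoped Quaternion

noncomputable section

/-- The standard positive definite quadratic form `x ↦ ∑ i, x i * x i` on `ℝ^(m+1)`. -/
abbrev stdForm (m : ℕ) : QuadraticForm ℝ (Fin (m + 1) → ℝ) :=
  QuadraticMap.weightedSumSquares ℝ (fun _ : Fin (m + 1) => (1 : ℝ))

/-- The real Clifford algebra `Cl*_{m+1}` of `ℝ^(m+1)` with its standard positive definite form;
it is generated by `E_0, …, E_m` subject to `E_i E_j + E_j E_i = 2 δ_ij`. -/
abbrev Cl (m : ℕ) : Type := CliffordAlgebra (stdForm m)

section Representations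

variable {A : Type*} [Ring A] [Algebra ℝ A]
variable {W : Type*} [AddCommGroup W] [Module ℝ W]
variable {W' : Type*} [AddCommGroup W'] [Module ℝ W']

/-- A real representation is irreducible if it is nonzero and has no proper nonzero invariant
subspace. -/
def IsIrreducibleRep (ρ : A →ₐ[ℝ] Module.End ℝ W) : Prop :=
  Nontrivial W ∧ ∀ S : Submodule ℝ W, (∀ a : A, ∀ w ∈ S, ρ a w ∈ S) → S = ⊥ ∨ S = ⊤

/-- Equivalence of real representations: there is an intertwining linear isomorphism. -/
def EquivalentRep (ρ : A →ₐ[ℝ] Module.End ℝ W) (σ : A →ₐ[ℝ] Module.End ℝ W') : Prop :=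
  ∃ e : W ≃ₗ[ℝ] W', ∀ (a : A) (w : W), e (ρ a w) = σ a (e w)

/-- The direct sum of `k` copies of a representation. -/
def copiesRep (ρ : A →ₐ[ℝ] Module.End ℝ W) (k : ℕ) : A →ₐ[ℝ] Module.End ℝ (Fin k → W) where
  toFun a := LinearMap.pi fun i => ρ a ∘ₗ LinearMap.proj i
  map_one' := by ext; simp
  map_mul' a b := by ext; simp
  map_zero' := by ext; simp
  map_add' a b := by ext; simp
  commutes' r := by
    refine LinearMap.ext fun w => funext fun i => ?_
    simp [Module.algebraMap_end_apply]

/-- The direct sum of two representations. -/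
def sumRep (ρ : A →ₐ[ℝ] Module.End ℝ W) (σ : A →ₐ[ℝ] Module.End ℝ W') :
    A →ₐ[ℝ] Module.End ℝ (W × W') where
  toFun a := (ρ a).prodMap (σ a)
  map_one' := by ext <;> simp
  map_mul' a b := by ext <;> simp
  map_zero' := by ext <;> simp
  map_add' a b := by ext <;> simp
  commutes' r := by
    refine LinearMap.ext fun w => ?_
    simp [Module.algebraMap_end_apply, Prod.smul_def]

end Representations

/-- The representation `ρ ∘ α`, where `α` is the canonical involution of the Clifford algebra,
that is, the automorphism extending `-Id` on `ℝ^(m+1)`. -/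
def twistRep {m : ℕ} {W : Type*} [AddCommGroup W] [Module ℝ W]
    (ρ : Cl m →ₐ[ℝ] Module.End ℝ W) : Cl m →ₐ[ℝ] Module.End ℝ W :=
  ρ.comp CliffordAlgebra.involute

/-- A symmetric Clifford system `(P_0, …, P_m)` on a Euclidean space `V`. -/
structure SymmetricCliffordSystem (m : ℕ) (V : Type*) [NormedAddCommGroup V]
    [InnerProductSpace ℝ V] where
  P : Fin (m + 1) → Module.End ℝ V
  symmetric : ∀ i, (P i).IsSymmetric
  anticomm : ∀ i j, P i * P j + P j * P i = (if i = j then (2 : ℝ) else 0) • 1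

namespace SymmetricCliffordSystem

variable {m : ℕ} {V : Type*} [NormedAddCommGroup V] [InnerProductSpace ℝ V]

/-- The space `span {P_0, …, P_m}` of endomorphisms. -/
def space (C : SymmetricCliffordSystem m V) : Submodule ℝ (Module.End ℝ V) :=
  Submodule.span ℝ (Set.range C.P)

theorem linearCombination_sq (C : SymmetricCliffordSystem m V) (x : Fin (m + 1) → ℝ) :
    Fintype.linearCombination ℝ C.P x * Fintype.linearCombination ℝ C.P x =
      algebraMap ℝ (Module.End ℝ V) (stdForm m x) := by
  have h : ∀ y : Module.End ℝ V, y + y = (2 : ℝ) • y := fun y => (two_smul ℝ y).symm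
  have key : (2 : ℝ) • (Fintype.linearCombination ℝ C.P x * Fintype.linearCombination ℝ C.P x) =
      (2 : ℝ) • algebraMap ℝ (Module.End ℝ V) (stdForm m x) := by
    rw [← h]
    simp only [Fintype.linearCombination_apply, Finset.sum_mul_sum]
    conv_lhs =>
      arg 2
      rw [Finset.sum_comm]
    simp only [← Finset.sum_add_distrib, smul_mul_smul_comm]
    have : ∀ i j : Fin (m + 1), (x i * x j) • (C.P i * C.P j) + (x j * x i) • (C.P j * C.P i) =
        (if i = j then x i * x j * 2 else 0) • (1 : Module.End ℝ V) := by
      intro i j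
      rw [mul_comm (x j), ← smul_add, C.anticomm, smul_smul]
      split_ifs <;> simp
    simp only [this, ← Finset.sum_smul, Finset.sum_ite_eq, Finset.mem_univ, if_true]
    rw [Algebra.algebraMap_eq_smul_one, smul_smul]
    simp [QuadraticMap.weightedSumSquares_apply, ← Finset.sum_mul, mul_comm]
  exact smul_right_injective _ (two_ne_zero) key

/-- The representation `χ` of the Clifford algebra on `V` with `χ(E_i) = P_i`. -/
def rep (C : SymmetricCliffordSystem m V) : Cl m →ₐ[ℝ] Module.End ℝ V :=
  CliffordAlgebra.lift (stdForm m) ⟨Fintype.linearCombination ℝ C.P, C.linearCombination_sq⟩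

theorem rep_ι_single (C : SymmetricCliffordSystem m V) (i : Fin (m + 1)) :
    C.rep (CliffordAlgebra.ι (stdForm m) (Pi.single i 1)) = C.P i := by
  simp [rep, Fintype.linearCombination_apply_single]

variable [CompleteSpace V]

/-- `U⁺(𝒫)`: the orthogonal transformations of `V` commuting with every element of
`𝒫 = span {P_0, …, P_m}`. The orthogonal group `O(V)` is the group of operators `U` with
`U* U = U U* = 1`, with the topology of the operator norm. -/
def uPlus (C : SymmetricCliffordSystem m V) : Subgroup (unitary (V →L[ℝ] V)) where
  carrier := {U | ∀ T ∈ C.space, ∀ v : V, T ((U : V →L[ℝ] V) v) = (U : V →L[ℝ] V) (T v)}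
  one_mem' := by intro T _ v; simp
  mul_mem' := by
    intro a b ha hb T hT v
    simp [ha T hT, hb T hT]
  inv_mem' := by
    intro a ha T hT v
    have h1 : ∀ v : V, (a : V →L[ℝ] V) (((a⁻¹ : unitary (V →L[ℝ] V)) : V →L[ℝ] V) v) = v := by
      intro v
      rw [← mul_apply_eq_comp, ← Submonoid.coe_mul, mul_inv_cancel]; simp
    have h2 : ∀ v : V, ((a⁻¹ : unitary (V →L[ℝ] V)) : V →L[ℝ] V) ((a : V →L[ℝ] V) v) = v := by
      intro v
      rw [← mul_apply_eq_comp, ← Submonoid.coe_mul, inv_mul_cancel]; simp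
    have h3 := ha T hT (((a⁻¹ : unitary (V →L[ℝ] V)) : V →L[ℝ] V) v)
    rw [h1] at h3
    rw [h3, h2]

end SymmetricCliffordSystem

/-- The orthogonal group `O(k)`. -/
abbrev OrthGroup (k : ℕ) := Matrix.orthogonalGroup (Fin k) ℝ

/-- The unitary group `U(k)`. -/
abbrev UnitGroup (k : ℕ) := Matrix.unitaryGroup (Fin k) ℂ

/-- The compact symplectic group `Sp(k)`: the quaternionic `k × k` matrices `A` with
`A* A = A A* = 1`. -/
abbrev SpGroup (k : ℕ) := unitary (Matrix (Fin k) (Fin k) ℍ[ℝ])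

end

/-!
Let `n = m + 1`. The representation theory needed is that of the finite group of signed products of
the generators `E_i`, and the argument is the one of Frobenius and Schur, carried out over `ℝ`.

The products of the generators are indexed by the sublists `s` of the list of all indices (`word`).
Summing `Q_s ∘ T ∘ P_s⁻¹` over all `s` turns any linear map `T : E → W` between two Clifford modules
into an intertwining map (`average`). All words have trace zero except the empty one and, for odd
`n`, the full one (`trace_word_eq_zero`), since any other word anticommutes with some generator.
Therefore the averages `E → W` cannot all vanish, unless `n` is odd and the full word acts on `W` by
the scalar opposite to that on `E`; the latter happens only for `n ≡ 1 mod 4`, where the full word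
is a central involution (`finrank_smul_add_eq_zero`). This gives the uniqueness of the irreducible
module for `m ≢ 0 mod 4`, its uniqueness up to the twist for `m ≡ 0 mod 4`, and, applied to
invariant projections of `V`, the fact that `V` is exhausted by copies of it (`exists_complete_family`,
`exists_complete_families`). The irreducible module can be taken to be an invariant subspace of `V`
or its negative (`exists_euclidean_model`), so it comes with an invariant inner product; by Schur's
lemma intertwining maps can be rescaled to isometries, and the decomposition of `V` is orthogonal.

For an irreducible Clifford system on a Euclidean space `E` of dimension `d`, a symmetric operator
in the commutant is a scalar. Taking traces of the average as an operator on `End E`, with and without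
composition with the transpose, gives two equations for `d` and the dimension `κ` of the commutant,
`2 ^ n * κ = ∑ tr(P_s) ^ 2` and `∑ tr(P_s) ^ 2 + ∑ tr(P_s ^ 2) = 2 ^ (n + 1)`. The sums are computed
from the signs of the squares of the words, and the resulting equations for `d > 0` and `κ` have one
solution, with `κ = 1, 2, 4` according to the residue of `m` modulo eight (`finrank_commutant_eq`). Skew
operators in the commutant square to negative scalars, so that `κ` determines the commutant as
`ℝ`, `ℂ` or `ℍ`, with the adjoint as conjugation.

Finally, an orthogonal decomposition of `V` into copies of `E` identifies the commutant of the
system on `V` with a matrix algebra over the commutant on `E`, or with a product of two of them, as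
a `*`-algebra (`exists_matrix_model`, `exists_matrix_prod_model`), and `U⁺` is its unitary group
(`IsCommutantModel.nonempty_uPlus_equiv`).
-/

noncomputable section

/-! ### Words in anticommuting involutions -/

section Words

variable {ι A : Type*} [Ring A]

/-- The product of the `Q i` along a list of indices. -/
def word (Q : ι → A) (s : List ι) : A := (s.map Q).prod

/-- The sign of the square of a product of `k` distinct anticommuting involutions, which is
`(-1) ^ (k * (k - 1) / 2)`. -/
def sqSign : ℕ → ℝ
  | 0 => 1
  | k + 1 => (-1) ^ k * sqSign k

@[simp] theorem word_nil (Q : ι → A) : word Q [] = 1 := rfl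

@[simp] theorem word_cons (Q : ι → A) (i : ι) (s : List ι) :
    word Q (i :: s) = Q i * word Q s := by simp [word]

theorem word_append (Q : ι → A) (s t : List ι) : word Q (s ++ t) = word Q s * word Q t := by
  simp [word]

theorem word_reverse_cons (Q : ι → A) (i : ι) (s : List ι) :
    word Q (i :: s).reverse = word Q s.reverse * Q i := by simp [word_append]

theorem word_neg [Algebra ℝ A] (Q : ι → A) (s : List ι) :
    word (fun i => -Q i) s = ((-1 : ℝ) ^ s.length) • word Q s := by
  induction s with
  | nil => simp
  | cons i s ih =>
    rw [word_cons, word_cons, ih, List.length_cons, pow_succ]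
    simp

variable [DecidableEq ι] [Algebra ℝ A]

/-- A family in a real algebra satisfying the Clifford relations
`Q i * Q j + Q j * Q i = 2 δ_ij`. -/
def IsCliffordFamily (Q : ι → A) : Prop :=
  ∀ i j, Q i * Q j + Q j * Q i = (if i = j then (2 : ℝ) else 0) • 1

namespace IsCliffordFamily

variable {Q : ι → A} (hQ : IsCliffordFamily Q)
include hQ

theorem mul_self (i : ι) : Q i * Q i = 1 := by
  have h := hQ i i
  rw [if_pos rfl, ← two_smul ℝ (Q i * Q i)] at h
  exact smul_right_injective A (two_ne_zero (α := ℝ)) h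

theorem mul_comm_neg {i j : ι} (h : i ≠ j) : Q i * Q j = -(Q j * Q i) := by
  have h' := hQ i j
  rw [if_neg h, zero_smul] at h'
  exact eq_neg_of_add_eq_zero_left h'

theorem neg : IsCliffordFamily (fun i => -Q i) := fun i j => by simpa using hQ i j

theorem word_mul_word_reverse (s : List ι) : word Q s * word Q s.reverse = 1 := by
  induction s with
  | nil => simp
  | cons i s ih =>
    rw [word_reverse_cons, word_cons, mul_assoc, ← mul_assoc (word Q s), ih, one_mul, hQ.mul_self]

theorem word_reverse_mul_word (s : List ι) : word Q s.reverse * word Q s = 1 := by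
  simpa using hQ.word_mul_word_reverse s.reverse

/-- A generator anticommutes with all letters of a word except its own occurrences. -/
theorem mul_word (i : ι) (s : List ι) :
    Q i * word Q s = ((-1 : ℝ) ^ (s.length + s.count i)) • (word Q s * Q i) := by
  induction s with
  | nil => simp
  | cons j s ih =>
    by_cases h : i = j
    · subst h
      rw [word_cons, mul_assoc, ih]
      simp only [List.length_cons, List.count_cons_self, mul_smul_comm]
      congr 1
      ring
    · rw [word_cons, ← mul_assoc, hQ.mul_comm_neg h, neg_mul, mul_assoc, ih,
        List.count_cons_of_ne (Ne.symm h)]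
      simp only [List.length_cons, mul_smul_comm, mul_assoc, ← neg_smul]
      congr 1
      ring

theorem word_mul_word_self {s : List ι} (hs : s.Nodup) :
    word Q s * word Q s = sqSign s.length • 1 := by
  induction s with
  | nil => simp [sqSign]
  | cons i s ih =>
    rw [List.nodup_cons] at hs
    rw [word_cons]
    nth_rewrite 1 [hQ.mul_word]
    rw [List.count_eq_zero_of_not_mem hs.1, smul_mul_assoc, mul_assoc, ← mul_assoc (Q i),
      hQ.mul_self, one_mul, ih hs.2, smul_smul]
    simp [sqSign]

/-- A word of odd length with distinct letters commutes with its letters: each letter anticommutes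
with all others, of which there is an even number. -/
theorem commute_word_of_odd {s : List ι} (hs : s.Nodup) (hodd : Odd s.length) {i : ι}
    (hi : i ∈ s) : Q i * word Q s = word Q s * Q i := by
  rw [hQ.mul_word, List.count_eq_one_of_mem hs hi, hodd.add_one.neg_one_pow, one_smul]

end IsCliffordFamily

theorem sqSign_mul_self (n : ℕ) : sqSign n * sqSign n = 1 := by
  induction n with
  | zero => simp [sqSign]
  | succ n ih =>
    rw [sqSign, mul_mul_mul_comm, ih, mul_one, ← mul_pow]
    simp

theorem sqSign_add_four (n : ℕ) : sqSign (n + 4) = sqSign n := by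
  rcases neg_one_pow_eq_or ℝ n with h | h <;> simp [sqSign, pow_succ, h]

theorem sqSign_mod_four (n : ℕ) : sqSign n = sqSign (n % 4) := by
  induction n using Nat.strong_induction_on with
  | _ n ih =>
    rcases Nat.lt_or_ge n 4 with h | h
    · rw [Nat.mod_eq_of_lt h]
    · obtain ⟨k, rfl⟩ := Nat.exists_eq_add_of_le' h
      rw [sqSign_add_four, ih k (by omega), Nat.add_mod_right]

theorem sqSign_of_mod_four_eq_one {n : ℕ} (hn : n % 4 = 1) : sqSign n = 1 := by
  rw [sqSign_mod_four, hn]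
  simp [sqSign]

theorem sqSign_of_mod_four_eq_three {n : ℕ} (hn : n % 4 = 3) : sqSign n = -1 := by
  rw [sqSign_mod_four, hn]
  simp [sqSign]

/-- The pair `(∑ sqSign |s|, ∑ (-1) ^ |s| * sqSign |s|)` of sums over the sublists `s` of a list of
length `n`;
these are the real and imaginary parts of `(1 + I) * (1 - I) ^ n`. -/
def signSums : ℕ → ℝ × ℝ
  | 0 => (1, 1)
  | n + 1 => ((signSums n).1 + (signSums n).2, (signSums n).2 - (signSums n).1)

theorem sum_sqSign_sublists {ι : Type*} (L : List ι) :
    (L.sublists'.map fun s => sqSign s.length).sum = (signSums L.length).1 ∧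
    (L.sublists'.map fun s => (-1) ^ s.length * sqSign s.length).sum = (signSums L.length).2 := by
  induction L with
  | nil => simp [sqSign, signSums]
  | cons i L ih =>
    have key : ∀ k : ℕ, (-1 : ℝ) ^ (k + 1) * ((-1) ^ k * sqSign k) = -sqSign k := fun k => by
      rw [← mul_assoc, ← pow_add, (by ring : k + 1 + k = 2 * k + 1), pow_succ, pow_mul]
      simp
    simp only [List.sublists'_cons, List.map_append, List.map_map, List.sum_append,
      Function.comp_def, List.length_cons, sqSign, key, signSums, ← ih.1, ← ih.2]
    rw [true_and, sub_eq_add_neg, List.sum_neg, List.map_map]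
    rfl

theorem signSums_add_eight (n : ℕ) :
    signSums (n + 8) = (16 * (signSums n).1, 16 * (signSums n).2) := by
  simp only [signSums]
  ext <;> ring

theorem signSums_add_eight_mul (q n : ℕ) :
    (signSums (n + 8 * q)).1 = 16 ^ q * (signSums n).1 := by
  induction q with
  | zero => simp
  | succ q ih => rw [mul_add, mul_one, ← add_assoc, signSums_add_eight, ih, pow_succ]; ring

end Words

section Trace

variable {ι W : Type*} [DecidableEq ι] [AddCommGroup W] [Module ℝ W]

/-- A word that anticommutes with one of the generators has trace zero. -/
theorem IsCliffordFamily.trace_word_eq_zero {Q : ι → Module.End ℝ W} (hQ : IsCliffordFamily Q)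
    {s : List ι} (hs : s.Nodup) (hne : s ≠ []) (hcase : Odd s.length → ∃ i, i ∉ s) :
    LinearMap.trace ℝ W (word Q s) = 0 := by
  obtain ⟨i, hi⟩ : ∃ i, Odd (s.length + s.count i) := by
    rcases Nat.even_or_odd s.length with he | ho
    · obtain ⟨i, hi⟩ := List.exists_mem_of_ne_nil s hne
      exact ⟨i, by rw [List.count_eq_one_of_mem hs hi]; exact he.add_one⟩
    · obtain ⟨i, hi⟩ := hcase ho
      exact ⟨i, by rwa [List.count_eq_zero_of_not_mem hi, add_zero]⟩
  have h1 := hQ.mul_word i s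
  rw [hi.neg_one_pow, neg_one_smul] at h1
  have h2 : LinearMap.trace ℝ W (word Q s) = -LinearMap.trace ℝ W (word Q s) := by
    calc LinearMap.trace ℝ W (word Q s)
        = LinearMap.trace ℝ W (Q i * (Q i * word Q s)) := by
          rw [← mul_assoc, hQ.mul_self, one_mul]
      _ = LinearMap.trace ℝ W (Q i * word Q s * Q i) := LinearMap.trace_mul_comm ℝ _ _
      _ = -LinearMap.trace ℝ W (word Q s) := by
          rw [h1, neg_mul, mul_assoc, hQ.mul_self, mul_one, map_neg]
  linarith

end Trace

/-! ### Averaging over words -/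

section Average

variable {ι E W : Type*} [AddCommGroup E] [Module ℝ E] [AddCommGroup W] [Module ℝ W]

/-- The sum of `Q_s ∘ T ∘ P_s⁻¹` over the sublists `s` of `L`, where `Q_s` is the word of `s` and
`P_s⁻¹` is written as the word of the reversed list. For anticommuting involutions this
is, up to a factor, the projection of `Hom(E, W)` onto the intertwining maps. -/
def average (P : ι → Module.End ℝ E) (Q : ι → Module.End ℝ W) (L : List ι) (T : E →ₗ[ℝ] W) :
    E →ₗ[ℝ] W :=
  (L.sublists'.map fun s => word Q s ∘ₗ T ∘ₗ word P s.reverse).sum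

@[simp] theorem average_nil (P : ι → Module.End ℝ E) (Q : ι → Module.End ℝ W) (T : E →ₗ[ℝ] W) :
    average P Q [] T = T := by
  simp [average, Module.End.one_eq_id]

theorem average_cons (P : ι → Module.End ℝ E) (Q : ι → Module.End ℝ W) (i : ι) (L : List ι)
    (T : E →ₗ[ℝ] W) :
    average P Q (i :: L) T = average P Q L T + Q i ∘ₗ average P Q L T ∘ₗ P i := by
  have h : ∀ l : List (E →ₗ[ℝ] W),
      (l.map fun S => Q i ∘ₗ S ∘ₗ P i).sum = Q i ∘ₗ l.sum ∘ₗ P i := fun l => by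
    induction l with
    | nil => simp
    | cons S l ih => simp [ih, LinearMap.add_comp, LinearMap.comp_add]
  simp only [average, List.sublists'_cons, List.map_append, List.sum_append]
  rw [← h, List.map_map, List.map_map]
  simp only [Function.comp_def, word_reverse_cons, word_cons, Module.End.mul_eq_comp,
    LinearMap.comp_assoc]

theorem average_add (P : ι → Module.End ℝ E) (Q : ι → Module.End ℝ W) (L : List ι)
    (S T : E →ₗ[ℝ] W) : average P Q L (S + T) = average P Q L S + average P Q L T := by
  induction L with
  | nil => simp
  | cons i L ih =>
    simp only [average_cons, ih, LinearMap.add_comp, LinearMap.comp_add]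
    abel

theorem average_smul (P : ι → Module.End ℝ E) (Q : ι → Module.End ℝ W) (L : List ι)
    (c : ℝ) (T : E →ₗ[ℝ] W) : average P Q L (c • T) = c • average P Q L T := by
  induction L with
  | nil => simp
  | cons i L ih => simp only [average_cons, ih, LinearMap.smul_comp, LinearMap.comp_smul, smul_add]

theorem comp_average (P : ι → Module.End ℝ E) (Q : ι → Module.End ℝ W) (L : List ι)
    {p : Module.End ℝ W} (hp : ∀ i, p * Q i = Q i * p) (T : E →ₗ[ℝ] W) :
    p ∘ₗ average P Q L T = average P Q L (p ∘ₗ T) := by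
  induction L with
  | nil => simp
  | cons i L ih =>
    simp only [average_cons, ← ih, LinearMap.comp_add, ← LinearMap.comp_assoc,
      ← Module.End.mul_eq_comp, hp]

variable [DecidableEq ι] {P : ι → Module.End ℝ E} {Q : ι → Module.End ℝ W}

theorem conj_average (hP : IsCliffordFamily P) (hQ : IsCliffordFamily Q) {L : List ι} {i : ι}
    (hi : i ∈ L) (T : E →ₗ[ℝ] W) : Q i ∘ₗ average P Q L T ∘ₗ P i = average P Q L T := by
  have hP' := fun v => LinearMap.congr_fun (hP.mul_self i) v
  have hQ' := fun v => LinearMap.congr_fun (hQ.mul_self i) v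
  simp only [Module.End.mul_apply, Module.End.one_apply] at hP' hQ'
  induction L with
  | nil => simp at hi
  | cons j L ih =>
    rw [average_cons]
    by_cases hij : i = j
    · subst hij
      ext v
      simp [hP', hQ', add_comm]
    · have ih' := ih ((List.mem_cons.1 hi).resolve_left hij)
      have h1 := fun v => LinearMap.congr_fun (hP.mul_comm_neg (Ne.symm hij)) v
      have h2 := fun v => LinearMap.congr_fun (hQ.mul_comm_neg hij) v
      simp only [Module.End.mul_apply, LinearMap.neg_apply] at h1 h2
      have ih'' := fun v => LinearMap.congr_fun ih' v
      simp only [LinearMap.comp_apply] at ih''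
      ext v
      simp only [LinearMap.comp_apply, LinearMap.add_apply, map_add, ih'', h1, h2, map_neg, neg_neg]

theorem average_intertwines (hP : IsCliffordFamily P) (hQ : IsCliffordFamily Q) {L : List ι} {i : ι}
    (hi : i ∈ L) (T : E →ₗ[ℝ] W) : average P Q L T ∘ₗ P i = Q i ∘ₗ average P Q L T := by
  conv_rhs => rw [← conj_average hP hQ hi]
  rw [← LinearMap.comp_assoc, ← Module.End.mul_eq_comp, hQ.mul_self, Module.End.one_eq_id,
    LinearMap.id_comp]

theorem average_of_intertwines (hQ : IsCliffordFamily Q) (L : List ι) {T : E →ₗ[ℝ] W}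
    (hT : ∀ i, T ∘ₗ P i = Q i ∘ₗ T) : average P Q L T = (2 : ℝ) ^ L.length • T := by
  induction L with
  | nil => simp
  | cons i L ih =>
    rw [average_cons, ih, LinearMap.smul_comp, LinearMap.comp_smul, hT, ← LinearMap.comp_assoc,
      ← Module.End.mul_eq_comp, hQ.mul_self, Module.End.one_eq_id, LinearMap.id_comp,
      List.length_cons, pow_succ, mul_two, add_smul]

/-- Only the empty word, and the full word if its length is odd, contribute to a sum weighted with
the traces of the words. -/
theorem sum_trace_word_smul [Module.Finite ℝ E] {n : ℕ} (hn : n ≠ 0) {P : Fin n → Module.End ℝ E}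
    (hP : IsCliffordFamily P) {M : Type*} [AddCommGroup M] [Module ℝ M]
    (F : List (Fin n) → M) :
    ((List.finRange n).sublists'.map fun s =>
      LinearMap.trace ℝ E (word P s.reverse) • F s).sum =
      (Module.finrank ℝ E : ℝ) • F [] +
        if Odd n then LinearMap.trace ℝ E (word P (List.finRange n).reverse) • F (List.finRange n)
        else 0 := by
  classical
  have hnd : (List.finRange n).sublists'.Nodup := List.nodup_sublists'.2 (List.nodup_finRange n)
  rw [← List.sum_toFinset _ hnd]
  have hne : ([] : List (Fin n)) ≠ List.finRange n := by
    intro h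
    have := congrArg List.length h
    simp at this
    omega
  rw [← Finset.sum_subset (s₁ := {[], List.finRange n}), Finset.sum_pair hne]
  · rw [List.reverse_nil, word_nil, LinearMap.trace_one]
    congr 1
    split_ifs with h
    · rfl
    · rw [hP.trace_word_eq_zero, zero_smul]
      · exact List.nodup_reverse.2 (List.nodup_finRange n)
      · simpa using hn
      · intro h'
        simp at h'
        exact absurd h' (by simpa using h)
  · intro s hs
    rw [List.mem_toFinset, List.mem_sublists']
    rcases Finset.mem_insert.1 hs with rfl | hs
    · simp
    · rw [Finset.mem_singleton.1 hs]
  · intro s hs hs'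
    rw [List.mem_toFinset, List.mem_sublists'] at hs
    simp only [Finset.mem_insert, Finset.mem_singleton, not_or] at hs'
    have hsn := hs.nodup (List.nodup_finRange n)
    rw [hP.trace_word_eq_zero (List.nodup_reverse.2 hsn) (by simpa using hs'.1), zero_smul]
    intro _
    -- A sublist containing all indices is the whole list.
    by_contra! hall
    simp only [List.mem_reverse] at hall
    refine hs'.2 (hs.eq_of_length_le ?_)
    exact (List.nodup_finRange n).subperm (fun i _ => hall i) |>.length_le

/-- If no nonzero intertwining map `E → W` has its image in the image of the invariant projection
`p`, then the average vanishes on all `p ∘ T`; contracting with the traces on `E` leaves a linear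
relation between the projection `p` and the full word on `W`. -/
theorem finrank_smul_add_eq_zero [Module.Finite ℝ E] {n : ℕ} (hn : n ≠ 0)
    {P : Fin n → Module.End ℝ E} {Q : Fin n → Module.End ℝ W}
    (hP : IsCliffordFamily P) (hQ : IsCliffordFamily Q) {p : Module.End ℝ W}
    (hp : ∀ i, p * Q i = Q i * p) (hp2 : p * p = p)
    (h : ∀ f : E →ₗ[ℝ] W, (∀ i, f ∘ₗ P i = Q i ∘ₗ f) → p ∘ₗ f = f → f = 0) :
    (Module.finrank ℝ E : ℝ) • p +
      (if Odd n then LinearMap.trace ℝ E (word P (List.finRange n).reverse) •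
        (word Q (List.finRange n) * p) else 0) = 0 := by
  have h0 : ∀ T : E →ₗ[ℝ] W, average P Q (List.finRange n) (p ∘ₗ T) = 0 := fun T => by
    refine h _ (fun i => average_intertwines hP hQ (List.mem_finRange i) _) ?_
    rw [comp_average P Q _ hp, ← LinearMap.comp_assoc, ← Module.End.mul_eq_comp, hp2]
  have h1 := sum_trace_word_smul hn hP (fun s => word Q s * p)
  simp only [word_nil, one_mul] at h1
  rw [← h1]
  let b := Module.finBasis ℝ E
  ext w
  -- Summing the averages of the rank-one maps `v ↦ b_j* (v) • p w`, evaluated at `b_j`, over `j`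
  -- produces the traces on `E`.
  have h2 : ∀ L : List (List (Fin n)),
      ((L.map fun s => LinearMap.trace ℝ E (word P s.reverse) • (word Q s * p)).sum) w =
      ∑ j, ((L.map fun s => word Q s ∘ₗ (p ∘ₗ (b.coord j).smulRight w) ∘ₗ
        word P s.reverse).sum) (b j) := by
    intro L
    induction L with
    | nil => simp
    | cons s L ih =>
      simp only [List.map_cons, List.sum_cons, LinearMap.add_apply, Finset.sum_add_distrib, ih]
      congr 1
      rw [LinearMap.trace_eq_matrix_trace ℝ b, Matrix.trace]
      simp [LinearMap.toMatrix_apply, Finset.sum_smul]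
  rw [h2]
  refine Finset.sum_eq_zero fun j _ => ?_
  have := LinearMap.congr_fun (h0 ((b.coord j).smulRight w)) (b j)
  simpa [average] using this

/-- The trace of `T ↦ B ∘ T ∘ A` on endomorphisms is `tr A * tr B`. -/
theorem trace_comp_comp [Module.Finite ℝ E] (A B : Module.End ℝ E) :
    LinearMap.trace ℝ (Module.End ℝ E) (LinearMap.mulLeft ℝ B ∘ₗ LinearMap.mulRight ℝ A) =
      LinearMap.trace ℝ E A * LinearMap.trace ℝ E B := by
  have h : LinearMap.mulLeft ℝ B ∘ₗ LinearMap.mulRight ℝ A = (dualTensorHomEquiv ℝ E E).conj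
      (TensorProduct.map (Module.Dual.transpose (R := ℝ) A) B) := by
    rw [LinearEquiv.conj_apply, LinearEquiv.eq_comp_toLinearMap_symm]
    refine TensorProduct.ext' fun x y => ?_
    ext v
    simp [dualTensorHomEquiv, Module.Dual.transpose_apply]
  rw [h]
  exact (LinearMap.trace_conj' (M := TensorProduct ℝ (Module.Dual ℝ E) E) (N := E →ₗ[ℝ] E)
    (TensorProduct.map (Module.Dual.transpose (R := ℝ) A) B)
    (dualTensorHomEquiv ℝ E E)).trans
      (by rw [LinearMap.trace_tensorProduct', LinearMap.trace_transpose'])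

end Average

/-! ### The Frobenius–Schur count for an irreducible Clifford system -/

namespace SymmetricCliffordSystem

variable {m : ℕ} {E : Type*} [NormedAddCommGroup E] [InnerProductSpace ℝ E]
  (C : SymmetricCliffordSystem m E)

theorem isCliffordFamily : IsCliffordFamily C.P := C.anticomm

/-- Irreducibility of the representation of a Clifford system, in terms of its operators. -/
def IsIrreducible : Prop :=
  Nontrivial E ∧ ∀ S : Submodule ℝ E, (∀ i, ∀ v ∈ S, C.P i v ∈ S) → S = ⊥ ∨ S = ⊤

/-- The algebra of endomorphisms commuting with all operators of a Clifford system. -/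
def commutant : Subalgebra ℝ (Module.End ℝ E) := Subalgebra.centralizer ℝ (Set.range C.P)

theorem mem_commutant {T : Module.End ℝ E} : T ∈ C.commutant ↔ ∀ i, C.P i * T = T * C.P i := by
  simp [commutant, Subalgebra.mem_centralizer_iff]

variable {C} in
theorem trace_average (L : List (Fin (m + 1))) (T : Module.End ℝ E) :
    LinearMap.trace ℝ E (average C.P C.P L T) = 2 ^ L.length * LinearMap.trace ℝ E T := by
  induction L with
  | nil => simp
  | cons i L ih =>
    simp only [average_cons, ← Module.End.mul_eq_comp]
    rw [map_add, LinearMap.trace_mul_comm, mul_assoc, C.isCliffordFamily.mul_self, mul_one, ih,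
      List.length_cons]
    ring

variable {C} in
theorem average_mem_commutant (T : Module.End ℝ E) :
    average C.P C.P (List.finRange (m + 1)) T ∈ C.commutant :=
  C.mem_commutant.2 fun i => (average_intertwines C.isCliffordFamily C.isCliffordFamily
    (List.mem_finRange i) T).symm

/-- The product of all operators of a Clifford system. -/
def fullWord : Module.End ℝ E := word C.P (List.finRange (m + 1))

theorem fullWord_mul_self : C.fullWord * C.fullWord = sqSign (m + 1) • 1 := by
  rw [fullWord, C.isCliffordFamily.word_mul_word_self (List.nodup_finRange _), List.length_finRange]

variable {C} in
theorem fullWord_mem_commutant (hm : Even m) : C.fullWord ∈ C.commutant :=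
  C.mem_commutant.2 fun i => C.isCliffordFamily.commute_word_of_odd (List.nodup_finRange _)
    (by simpa using hm.add_one) (List.mem_finRange i)

variable [FiniteDimensional ℝ E]

theorem star_P (i : Fin (m + 1)) : star (C.P i) = C.P i :=
  (LinearMap.isSymmetric_iff_isSelfAdjoint _).1 (C.symmetric i)

theorem star_mem_commutant {T : Module.End ℝ E} (hT : T ∈ C.commutant) :
    star T ∈ C.commutant := by
  rw [mem_commutant] at hT ⊢
  intro i
  have := congrArg star (hT i)
  rw [star_mul, star_mul, C.star_P] at this
  exact this.symm

theorem star_word (s : List (Fin (m + 1))) : star (word C.P s) = word C.P s.reverse := by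
  induction s with
  | nil => simp
  | cons i s ih => rw [word_cons, star_mul, ih, C.star_P, word_reverse_cons]

theorem _root_.LinearMap.trace_star_real (T : Module.End ℝ E) :
    LinearMap.trace ℝ E (star T) = LinearMap.trace ℝ E T := by
  have b := stdOrthonormalBasis ℝ E
  rw [LinearMap.trace_eq_sum_inner _ b, LinearMap.trace_eq_sum_inner _ b]
  refine Finset.sum_congr rfl fun i _ => ?_
  rw [LinearMap.star_eq_adjoint, LinearMap.adjoint_inner_right, real_inner_comm]

theorem trace_word_reverse (s : List (Fin (m + 1))) :
    LinearMap.trace ℝ E (word C.P s.reverse) = LinearMap.trace ℝ E (word C.P s) := by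
  rw [← star_word, LinearMap.trace_star_real]

variable {C}

theorem star_average (L : List (Fin (m + 1))) (T : Module.End ℝ E) :
    star (average C.P C.P L T : Module.End ℝ E) = average C.P C.P L (star T) := by
  induction L with
  | nil => simp
  | cons i L ih =>
    simp only [average_cons, ← Module.End.mul_eq_comp]
    rw [star_add, star_mul, star_mul, C.star_P, ih, mul_assoc]

/-- Schur's lemma for symmetric operators: an eigenspace is invariant. -/
theorem IsIrreducible.exists_eq_smul_one (hC : C.IsIrreducible) {T : Module.End ℝ E}
    (hT : T ∈ C.commutant) (hs : star T = T) : ∃ c : ℝ, T = c • 1 := by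
  have := hC.1
  have hsym : T.IsSymmetric := (LinearMap.isSymmetric_iff_isSelfAdjoint _).2 hs
  have hev := hsym.hasEigenvalue_iSup_of_finiteDimensional
  generalize (⨆ x : { x : E // x ≠ 0 }, (RCLike.re (inner ℝ (T x) x) : ℝ) / ‖(x : E)‖ ^ 2 : ℝ) = c
    at hev
  refine ⟨c, ?_⟩
  have hinv : ∀ i, ∀ v ∈ Module.End.eigenspace T c, C.P i v ∈ Module.End.eigenspace T c := by
    intro i v hv
    rw [Module.End.mem_eigenspace_iff] at hv ⊢
    have := LinearMap.congr_fun (C.mem_commutant.1 hT i) v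
    simp only [Module.End.mul_apply] at this
    rw [← this, hv, map_smul]
  rcases hC.2 _ hinv with h | h
  · exact absurd h hev
  · ext v
    have : v ∈ Module.End.eigenspace T c := h ▸ Submodule.mem_top
    simpa using Module.End.mem_eigenspace_iff.1 this

/-- The average of a symmetric operator over all words is a scalar, determined by its trace. -/
theorem IsIrreducible.average_add_star (hC : C.IsIrreducible) (T : Module.End ℝ E) :
    (Module.finrank ℝ E : ℝ) • average C.P C.P (List.finRange (m + 1)) (T + star T) =
      (2 ^ (m + 2) * LinearMap.trace ℝ E T) • 1 := by
  obtain ⟨c, hc⟩ := hC.exists_eq_smul_one (average_mem_commutant (T + star T))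
    (by rw [star_average, star_add, star_star, add_comm (star T)])
  have h := congrArg (LinearMap.trace ℝ E) hc
  rw [trace_average, map_smul, map_add, LinearMap.trace_star_real, LinearMap.trace_one,
    List.length_finRange, smul_eq_mul] at h
  rw [hc, smul_smul, mul_comm, ← h]
  congr 1
  ring

/-- The Frobenius–Schur identity: contracting `average_add_star` for the operators of rank one in
the two possible ways gives the sum of squares of traces and the sum of traces of squares. -/
theorem IsIrreducible.sum_trace_sq_add_sum_trace_mul_self (hC : C.IsIrreducible) :
    ((List.finRange (m + 1)).sublists'.map fun s =>
      LinearMap.trace ℝ E (word C.P s) * LinearMap.trace ℝ E (word C.P s)).sum +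
    ((List.finRange (m + 1)).sublists'.map fun s =>
      LinearMap.trace ℝ E (word C.P s * word C.P s)).sum = 2 ^ (m + 2) := by
  have := hC.1
  have hd : (Module.finrank ℝ E : ℝ) ≠ 0 := by exact_mod_cast Module.finrank_pos.ne'
  let b := stdOrthonormalBasis ℝ E
  let T : Fin (Module.finrank ℝ E) → Fin (Module.finrank ℝ E) → Module.End ℝ E := fun i j =>
    (InnerProductSpace.rankOne ℝ (b i) (b j)).toLinearMap
  have hT' : ∀ i j v, T i j v = inner ℝ (b j) v • b i := fun i j v => by simp [T]
  have hT : ∀ i j, star (T i j) = T j i := fun i j => by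
    rw [LinearMap.star_eq_adjoint, eq_comm, LinearMap.eq_adjoint_iff]
    intro v w
    rw [hT', hT', inner_smul_left, inner_smul_right, real_inner_comm v]
    simp [mul_comm]
  have htr : ∀ i j, LinearMap.trace ℝ E (T i j) = if i = j then 1 else 0 := fun i j => by
    rw [LinearMap.trace_eq_sum_inner _ b]
    simp only [hT', inner_smul_right, b.inner_eq_ite]
    simp [eq_comm]
  -- The rank-one operators `T i j` give `∑ tr(P_s) ^ 2`, and their adjoints `∑ tr(P_s ^ 2)`.
  have h1 : ∀ L : List (List (Fin (m + 1))),
      (L.map fun s => LinearMap.trace ℝ E (word C.P s) * LinearMap.trace ℝ E (word C.P s)).sum +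
      (L.map fun s => LinearMap.trace ℝ E (word C.P s * word C.P s)).sum =
      ∑ i, ∑ j, inner ℝ (b i)
        (((L.map fun s =>
          word C.P s ∘ₗ (T i j + star (T i j)) ∘ₗ word C.P s.reverse).sum) (b j)) := by
    intro L
    induction L with
    | nil => simp
    | cons s L ih =>
      simp only [List.map_cons, List.sum_cons, LinearMap.add_apply, inner_add_right,
        Finset.sum_add_distrib, ← ih]
      have h2 : LinearMap.trace ℝ E (word C.P s) * LinearMap.trace ℝ E (word C.P s) =
        ∑ i, ∑ j, inner ℝ (b i) ((word C.P s ∘ₗ T i j ∘ₗ word C.P s.reverse) (b j)) := by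
        rw [LinearMap.trace_eq_sum_inner _ b, Finset.sum_mul_sum]
        refine Finset.sum_congr rfl fun i _ => Finset.sum_congr rfl fun j _ => ?_
        simp only [LinearMap.comp_apply, hT', ← star_word, map_smul, inner_smul_right,
          LinearMap.star_eq_adjoint, LinearMap.adjoint_inner_right]
        rw [mul_comm, real_inner_comm]
      have h3 : LinearMap.trace ℝ E (word C.P s * word C.P s) =
        ∑ i, ∑ j, inner ℝ (b i) ((word C.P s ∘ₗ star (T i j) ∘ₗ word C.P s.reverse) (b j)) := by
        rw [LinearMap.trace_eq_sum_inner _ b]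
        refine Finset.sum_congr rfl fun i _ => ?_
        simp only [LinearMap.comp_apply, hT, hT', ← star_word, map_smul, inner_smul_right,
          LinearMap.star_eq_adjoint, LinearMap.adjoint_inner_right]
        rw [Module.End.mul_apply, ← LinearMap.adjoint_inner_left, ← b.sum_inner_mul_inner]
        refine Finset.sum_congr rfl fun j _ => ?_
        rw [LinearMap.adjoint_inner_left, mul_comm, real_inner_comm (b j)]
      rw [h2, h3]
      simp only [LinearMap.comp_apply, LinearMap.add_apply, map_add, inner_add_right,
        Finset.sum_add_distrib]
      ring
  rw [h1]
  refine mul_left_cancel₀ hd ?_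
  rw [Finset.mul_sum]
  have h4 : ∀ i j, (Module.finrank ℝ E : ℝ) * inner ℝ (b i)
      ((average C.P C.P (List.finRange (m + 1)) (T i j + star (T i j))) (b j)) =
      if i = j then 2 ^ (m + 2) else 0 := fun i j => by
    rw [← inner_smul_right, ← LinearMap.smul_apply, hC.average_add_star, htr]
    split_ifs with h
    · subst h
      simp [inner_smul_right]
    · simp
  simp only [average] at h4
  simp only [Finset.mul_sum, h4]
  simp

/-- Averaging is, up to a factor, the projection to the commutant. -/
theorem finrank_commutant : (2 : ℝ) ^ (m + 1) * Module.finrank ℝ C.commutant =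
    ((List.finRange (m + 1)).sublists'.map fun s =>
      LinearMap.trace ℝ E (word C.P s) * LinearMap.trace ℝ E (word C.P s)).sum := by
  have hC := C.isCliffordFamily
  let F : Module.End ℝ E →ₗ[ℝ] Module.End ℝ E :=
    { toFun := fun T => ((2 : ℝ) ^ (m + 1))⁻¹ • average C.P C.P (List.finRange (m + 1)) T
      map_add' := fun S T => by rw [average_add, smul_add]
      map_smul' := fun c T => by rw [average_smul, smul_comm, RingHom.id_apply] }
  have hF : LinearMap.IsProj (Subalgebra.toSubmodule C.commutant) F :=
    { map_mem := fun T => Submodule.smul_mem _ _ (average_mem_commutant T)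
      map_id := fun T hT => by
        have := average_of_intertwines hC (List.finRange (m + 1)) (T := T) (P := C.P)
          fun i => (C.mem_commutant.1 hT i).symm
        simp only [F, LinearMap.coe_mk, AddHom.coe_mk]
        rw [this, smul_smul, List.length_finRange, inv_mul_cancel₀ (by positivity), one_smul] }
  have h := hF.trace
  have h2 : ∀ L : List (List (Fin (m + 1))), (L.map fun s =>
      LinearMap.trace ℝ E (word C.P s) * LinearMap.trace ℝ E (word C.P s)).sum =
      LinearMap.trace ℝ (Module.End ℝ E) (L.map fun s =>
        LinearMap.mulLeft ℝ (word C.P s) ∘ₗ LinearMap.mulRight ℝ (word C.P s.reverse)).sum := by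
    intro L
    induction L with
    | nil => simp
    | cons s L ih =>
      rw [List.map_cons, List.sum_cons, List.map_cons, List.sum_cons, ih, map_add, trace_comp_comp,
        trace_word_reverse]
  have h3 : ∀ L : List (List (Fin (m + 1))), ∀ T, (L.map fun s =>
        LinearMap.mulLeft ℝ (word C.P s) ∘ₗ LinearMap.mulRight ℝ (word C.P s.reverse)).sum T =
        (L.map fun s => word C.P s ∘ₗ T ∘ₗ word C.P s.reverse).sum := by
    intro L T
    induction L with
    | nil => simp
    | cons s L ih =>
      simp only [List.map_cons, List.sum_cons, LinearMap.add_apply, ih]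
      rfl
  have h4 : ((List.finRange (m + 1)).sublists'.map fun s =>
        LinearMap.mulLeft ℝ (word C.P s) ∘ₗ LinearMap.mulRight ℝ (word C.P s.reverse)).sum =
        (2 : ℝ) ^ (m + 1) • F := by
    refine LinearMap.ext fun T => ?_
    rw [h3, LinearMap.smul_apply]
    simp only [F, LinearMap.coe_mk, AddHom.coe_mk]
    rw [smul_smul, mul_inv_cancel₀ (by positivity), one_smul]
    rfl
  rw [h2, h4, map_smul, h, smul_eq_mul]
  rfl

theorem star_fullWord : star C.fullWord = sqSign (m + 1) • C.fullWord := by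
  have h1 : star C.fullWord * C.fullWord = 1 := by
    rw [fullWord, star_word, C.isCliffordFamily.word_reverse_mul_word]
  have h2 : sqSign (m + 1) * sqSign (m + 1) = 1 := sqSign_mul_self _
  calc star C.fullWord = sqSign (m + 1) • (star C.fullWord * (C.fullWord * C.fullWord)) := by
        rw [fullWord_mul_self, mul_smul_comm, smul_smul, h2, one_smul, mul_one]
    _ = sqSign (m + 1) • C.fullWord := by rw [← mul_assoc, h1, one_mul]

theorem trace_fullWord_eq_zero (hm : m % 4 = 2) : LinearMap.trace ℝ E C.fullWord = 0 := by
  have h := LinearMap.trace_star_real C.fullWord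
  rw [star_fullWord, sqSign_of_mod_four_eq_three (by omega), neg_one_smul, map_neg] at h
  linarith

theorem IsIrreducible.fullWord_eq (hC : C.IsIrreducible) (hm : m % 4 = 0) :
    ∃ δ : ℝ, δ * δ = 1 ∧ C.fullWord = δ • 1 := by
  have := hC.1
  have hs := sqSign_of_mod_four_eq_one (n := m + 1) (by omega)
  obtain ⟨δ, h⟩ := hC.exists_eq_smul_one
    (fullWord_mem_commutant (C := C) (Nat.even_iff.2 (by omega)))
    (by rw [star_fullWord, hs, one_smul])
  refine ⟨δ, ?_, h⟩
  have h2 := C.fullWord_mul_self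
  rw [h, hs, one_smul, smul_mul_smul_comm, mul_one] at h2
  exact smul_left_injective ℝ (one_ne_zero (α := Module.End ℝ E)) (by simpa using h2)

theorem IsIrreducible.finrank_commutant_mul (hC : C.IsIrreducible) :
    (2 : ℝ) ^ (m + 1) * Module.finrank ℝ C.commutant =
      (if m % 4 = 0 then 2 else 1) * (Module.finrank ℝ E : ℝ) ^ 2 := by
  have h := sum_trace_word_smul (by omega : m + 1 ≠ 0) C.isCliffordFamily
    (fun s => LinearMap.trace ℝ E (word C.P s))
  simp only [smul_eq_mul, trace_word_reverse, word_nil, LinearMap.trace_one] at h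
  rw [finrank_commutant, h]
  change _ + (if _ then LinearMap.trace ℝ E C.fullWord * LinearMap.trace ℝ E C.fullWord else 0) = _
  by_cases h0 : m % 4 = 0
  · rw [if_pos h0, if_pos (Nat.odd_iff.2 (by omega))]
    obtain ⟨δ, hδ, hw⟩ := hC.fullWord_eq h0
    rw [hw, map_smul, LinearMap.trace_one, smul_eq_mul]
    linear_combination (Module.finrank ℝ E : ℝ) ^ 2 * hδ
  · rw [if_neg h0]
    split_ifs with ho
    · rw [Nat.odd_iff] at ho
      rw [trace_fullWord_eq_zero (by omega)]
      ring
    · ring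

theorem IsIrreducible.finrank_commutant_add (hC : C.IsIrreducible) :
    (2 : ℝ) ^ (m + 1) * Module.finrank ℝ C.commutant +
      Module.finrank ℝ E * (signSums (m + 1)).1 = 2 ^ (m + 2) := by
  have hs := (sum_sqSign_sublists (List.finRange (m + 1))).1
  rw [List.length_finRange] at hs
  rw [← hC.sum_trace_sq_add_sum_trace_mul_self, finrank_commutant, ← hs]
  congr 1
  rw [← List.sum_map_mul_left]
  congr 1
  refine List.map_congr_left fun s hs => ?_
  rw [C.isCliffordFamily.word_mul_word_self
    ((List.mem_sublists'.1 hs).nodup (List.nodup_finRange _)), map_smul, LinearMap.trace_one,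
    smul_eq_mul, mul_comm]

/-- The commutant of an irreducible Clifford system has dimension one, two or four, depending
on the residue of `m` modulo eight. -/
theorem IsIrreducible.finrank_commutant_eq (hC : C.IsIrreducible) :
    (m % 8 = 0 ∨ m % 8 = 1 ∨ m % 8 = 7 → Module.finrank ℝ C.commutant = 1) ∧
    (m % 8 = 2 ∨ m % 8 = 6 → Module.finrank ℝ C.commutant = 2) ∧
    (m % 8 = 3 ∨ m % 8 = 4 ∨ m % 8 = 5 → Module.finrank ℝ C.commutant = 4) := by
  have := hC.1
  have h1 := hC.finrank_commutant_mul
  have h2 := hC.finrank_commutant_add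
  have hd : (0 : ℝ) < Module.finrank ℝ E := by exact_mod_cast Module.finrank_pos
  obtain ⟨q, r, hr, rfl⟩ : ∃ q r, r < 8 ∧ m = r + 8 * q :=
    ⟨m / 8, m % 8, Nat.mod_lt _ (by norm_num), by omega⟩
  rw [(by ring : r + 8 * q + 1 = (r + 1) + 8 * q), signSums_add_eight_mul] at h2
  rw [(by ring : r + 8 * q + 1 = (r + 1) + 8 * q), pow_add, pow_mul] at h1
  rw [(by ring : r + 8 * q + 2 = (r + 2) + 8 * q), pow_add _ (r + 1), pow_add _ (r + 2),
    pow_mul] at h2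
  -- Normalizing the dimension by `16 ^ q` removes the dependence on `q`.
  obtain ⟨x, hx⟩ : ∃ x : ℝ, (Module.finrank ℝ E : ℝ) = 16 ^ q * x :=
    ⟨Module.finrank ℝ E / 16 ^ q, by field_simp⟩
  have hq : (0 : ℝ) < 16 ^ q := by positivity
  have hx0 : 0 < x := by
    rw [hx] at hd
    exact (mul_pos_iff_of_pos_left hq).1 hd
  have h16 : ((2 : ℝ) ^ 8) ^ q = 16 ^ q * 16 ^ q := by rw [← mul_pow]; norm_num
  generalize Module.finrank ℝ C.commutant = κ at *
  rw [hx, h16] at h1 h2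
  have h1' : 2 ^ (r + 1) * (κ : ℝ) = (if (r + 8 * q) % 4 = 0 then 2 else 1) * x ^ 2 := by
    refine mul_left_cancel₀ (mul_pos hq hq).ne' ?_
    linear_combination h1
  have h2' : 2 ^ (r + 1) * (κ : ℝ) + x * (signSums (r + 1)).1 = 2 ^ (r + 2) := by
    refine mul_left_cancel₀ (mul_pos hq hq).ne' ?_
    linear_combination h2
  have hmod : (r + 8 * q) % 8 = r := by omega
  have hmod4 : (r + 8 * q) % 4 = r % 4 := by omega
  rw [hmod]
  rw [hmod4] at h1'
  -- Unless the sum of signs vanishes, eliminating `κ` leaves a quadratic equation for `x` with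
  -- exactly one positive root.
  have root : ∀ a b : ℝ, 0 < b → (x - a) * (x + b) = 0 → x = a := fun a b hb h => by
    rcases mul_eq_zero.1 h with h | h <;> linarith
  clear h1 h2 hx h16 hd hmod hmod4
  have key : ∀ k : ℕ, (κ : ℝ) = k → κ = k := fun k h => by exact_mod_cast h
  interval_cases r <;> norm_num [signSums] at h1' h2' ⊢ <;> refine key _ ?_ <;> push_cast
  · have := root 1 2 (by norm_num) (by linarith)
    subst this; linarith
  · have := root 2 4 (by norm_num) (by linarith)
    subst this; linarith
  · linarith
  · have := root 8 4 (by norm_num) (by linarith)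
    subst this; linarith
  · have := root 8 4 (by norm_num) (by linarith)
    subst this; linarith
  · have := root 16 8 (by norm_num) (by linarith)
    subst this; linarith
  · linarith
  · have := root 16 32 (by norm_num) (by linarith)
    subst this; linarith

end SymmetricCliffordSystem

/-! ### The commutant of an irreducible Clifford system -/

namespace SymmetricCliffordSystem

variable {m : ℕ} {E : Type*} [NormedAddCommGroup E] [InnerProductSpace ℝ E]
  [FiniteDimensional ℝ E] {C : SymmetricCliffordSystem m E}

/-- A nonzero skew-symmetric operator in the commutant is a multiple of a complex structure. -/
theorem IsIrreducible.exists_smul_mul_self (hC : C.IsIrreducible) {A : Module.End ℝ E}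
    (hA : A ∈ C.commutant) (hs : star A = -A) (h0 : A ≠ 0) :
    ∃ c : ℝ, (c • A) * (c • A) = -1 := by
  have := hC.1
  obtain ⟨b, hb⟩ := hC.exists_eq_smul_one (mul_mem hA hA) (by rw [star_mul, hs, neg_mul_neg])
  have hneg : b < 0 := by
    by_contra! hnn
    obtain ⟨v, hv⟩ : ∃ v, A v ≠ 0 := by
      by_contra! hv
      exact h0 (LinearMap.ext hv)
    have h1 : inner ℝ (A v) (A v) = -(b * inner ℝ v v) := by
      have h2 := LinearMap.congr_fun hb v
      simp only [Module.End.mul_apply, LinearMap.smul_apply, Module.End.one_apply] at h2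
      rw [← LinearMap.adjoint_inner_right, ← LinearMap.star_eq_adjoint, hs, LinearMap.neg_apply, h2,
        inner_neg_right, inner_smul_right]
    have h3 : 0 < inner ℝ (A v) (A v) := real_inner_self_pos.2 hv
    have h4 : 0 ≤ b * inner ℝ v v := mul_nonneg hnn real_inner_self_nonneg
    linarith
  refine ⟨(√(-b))⁻¹, ?_⟩
  rw [smul_mul_smul_comm, hb, smul_smul, ← mul_inv, Real.mul_self_sqrt (by linarith), inv_neg,
    neg_mul, inv_mul_cancel₀ hneg.ne, neg_one_smul]

theorem IsIrreducible.exists_eq_smul_one_add (hC : C.IsIrreducible) {T : Module.End ℝ E}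
    (hT : T ∈ C.commutant) : ∃ a : ℝ, ∃ A ∈ C.commutant, star A = -A ∧ T = a • 1 + A := by
  have hT' := star_mem_commutant C hT
  obtain ⟨a, ha⟩ := hC.exists_eq_smul_one (add_mem hT hT') (by rw [star_add, star_star, add_comm])
  refine ⟨a / 2, (2 : ℝ)⁻¹ • (T - star T), Subalgebra.smul_mem _ (sub_mem hT hT') _, ?_, ?_⟩
  · rw [star_smul, star_sub, star_star, star_trivial, ← smul_neg, neg_sub]
  · rw [div_eq_inv_mul, mul_smul, ← ha, ← smul_add]
    simp only [add_add_sub_cancel]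
    rw [← two_smul ℝ T, smul_smul, inv_mul_cancel₀ two_ne_zero, one_smul]

/-- A commutant containing more than the scalars contains a complex structure. -/
theorem IsIrreducible.exists_complex_structure (hC : C.IsIrreducible)
    (h : 1 < Module.finrank ℝ C.commutant) :
    ∃ J ∈ C.commutant, star J = -J ∧ J * J = -1 := by
  obtain ⟨T, hT, hT1⟩ : ∃ T ∈ C.commutant, T ∉ Submodule.span ℝ {(1 : Module.End ℝ E)} := by
    by_contra! hall
    have := Submodule.finrank_mono (s := Subalgebra.toSubmodule C.commutant) hall
    exact absurd (this.trans (finrank_span_le_card _)) (by simpa using h)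
  obtain ⟨a, A, hA, hs, rfl⟩ := hC.exists_eq_smul_one_add hT
  obtain ⟨c, hc⟩ := hC.exists_smul_mul_self hA hs (by
    rintro rfl
    exact hT1 (by simpa using Submodule.smul_mem _ _ (Submodule.mem_span_singleton_self _)))
  exact ⟨c • A, Subalgebra.smul_mem _ hA _, by rw [star_smul, hs, star_trivial, smul_neg], hc⟩

/-- A commutant of dimension greater than two contains two anticommuting complex structures,
obtained from a third direction by the Gram–Schmidt process for `(A, B) ↦ A * B + B * A`. -/
theorem IsIrreducible.exists_quaternion_structure (hC : C.IsIrreducible)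
    (h : 2 < Module.finrank ℝ C.commutant) :
    ∃ I ∈ C.commutant, ∃ J ∈ C.commutant, star I = -I ∧ star J = -J ∧ I * I = -1 ∧ J * J = -1 ∧
      J * I = -(I * J) := by
  obtain ⟨I, hI, hIs, hII⟩ := hC.exists_complex_structure (by omega)
  obtain ⟨T, hT, hT1⟩ : ∃ T ∈ C.commutant, T ∉ Submodule.span ℝ {(1 : Module.End ℝ E), I} := by
    by_contra! hall
    have := Submodule.finrank_mono (s := Subalgebra.toSubmodule C.commutant) hall
    have h2 : Module.finrank ℝ (Submodule.span ℝ {(1 : Module.End ℝ E), I}) ≤ 2 := by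
      classical
      refine (finrank_span_le_card _).trans ?_
      rw [Set.toFinset_insert, Set.toFinset_singleton]
      exact Finset.card_le_two
    exact absurd (this.trans h2) (by simpa using h)
  obtain ⟨a, A, hA, hs, rfl⟩ := hC.exists_eq_smul_one_add hT
  obtain ⟨b, hb⟩ := hC.exists_eq_smul_one (add_mem (mul_mem hA hI) (mul_mem hI hA))
    (by rw [star_add, star_mul, star_mul, hs, hIs, neg_mul_neg, neg_mul_neg, add_comm])
  have hB : A + (b / 2) • I ∈ C.commutant := add_mem hA (Subalgebra.smul_mem _ hI _)
  have hBs : star (A + (b / 2) • I) = -(A + (b / 2) • I) := by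
    rw [star_add, star_smul, hs, hIs, star_trivial, smul_neg, neg_add]
  have hBI : (A + (b / 2) • I) * I = -(I * (A + (b / 2) • I)) := by
    rw [eq_neg_iff_add_eq_zero, add_mul, mul_add, add_add_add_comm, hb, smul_mul_assoc,
      mul_smul_comm, hII, ← add_smul, smul_neg, add_halves, add_neg_cancel]
  obtain ⟨c, hc⟩ := hC.exists_smul_mul_self hB hBs (by
    intro h0
    rw [add_eq_zero_iff_eq_neg] at h0
    refine hT1 (Submodule.mem_span_pair.2 ⟨a, -(b / 2), ?_⟩)
    rw [h0, neg_smul])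
  refine ⟨I, hI, _, Subalgebra.smul_mem _ hB c, hIs, ?_, hII, hc, ?_⟩
  · rw [star_smul, hBs, star_trivial, smul_neg]
  · rw [smul_mul_assoc, hBI, mul_smul_comm, smul_neg]

/-- The `*`-homomorphism `τ` is an isomorphism onto the commutant of the Clifford system. -/
structure IsCommutantModel {K : Type*} [Ring K] [StarRing K] [Algebra ℝ K]
    (C : SymmetricCliffordSystem m E) (τ : K →⋆ₐ[ℝ] Module.End ℝ E) : Prop where
  injective : Function.Injective τ
  mem_range : ∀ T, (∃ x, τ x = T) ↔ T ∈ C.commutant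

theorem isCommutantModel_of_finrank_eq [Nontrivial E] {K : Type*} [DivisionRing K] [StarRing K]
    [Algebra ℝ K] [Module.Finite ℝ K] (τ : K →⋆ₐ[ℝ] Module.End ℝ E)
    (h1 : ∀ x, τ x ∈ C.commutant) (h2 : Module.finrank ℝ K = Module.finrank ℝ C.commutant) :
    IsCommutantModel C τ := by
  have hinj : Function.Injective τ := (τ : K →+* Module.End ℝ E).injective
  refine ⟨hinj, fun T => ⟨?_, fun hT => ?_⟩⟩
  · rintro ⟨x, rfl⟩
    exact h1 x
  · have hr : LinearMap.range τ.toAlgHom.toLinearMap = Subalgebra.toSubmodule C.commutant := by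
      refine Submodule.eq_of_le_of_finrank_eq ?_ ?_
      · rintro _ ⟨x, rfl⟩
        exact h1 x
      · rw [LinearMap.finrank_range_of_inj hinj, h2]
        rfl
    have hT' : T ∈ Subalgebra.toSubmodule C.commutant := hT
    rw [← hr] at hT'
    exact hT'

theorem IsIrreducible.exists_real_model (hC : C.IsIrreducible)
    (h : Module.finrank ℝ C.commutant = 1) :
    ∃ τ : ℝ →⋆ₐ[ℝ] Module.End ℝ E, IsCommutantModel C τ := by
  have := hC.1
  refine ⟨⟨Algebra.ofId ℝ _, fun r => ?_⟩, isCommutantModel_of_finrank_eq _ (fun r => ?_) ?_⟩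
  · simp [Algebra.algebraMap_eq_smul_one]
  · exact Subalgebra.algebraMap_mem _ r
  · rw [h, Module.finrank_self]

theorem IsIrreducible.exists_complex_model (hC : C.IsIrreducible)
    (h : Module.finrank ℝ C.commutant = 2) :
    ∃ τ : ℂ →⋆ₐ[ℝ] Module.End ℝ E, IsCommutantModel C τ := by
  have := hC.1
  obtain ⟨J, hJ, hs, hJJ⟩ := hC.exists_complex_structure (by omega)
  refine ⟨⟨Complex.lift ⟨J, hJJ⟩, fun z => ?_⟩, isCommutantModel_of_finrank_eq _ (fun z => ?_) ?_⟩
  · simp [Complex.liftAux_apply, Algebra.algebraMap_eq_smul_one, hs]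
  · change Complex.lift ⟨J, hJJ⟩ z ∈ _
    rw [Complex.lift_apply, Complex.liftAux_apply]
    exact add_mem (Subalgebra.algebraMap_mem _ _) (Subalgebra.smul_mem _ hJ _)
  · rw [h, Complex.finrank_real_complex]

theorem IsIrreducible.exists_quaternion_model (hC : C.IsIrreducible)
    (h : Module.finrank ℝ C.commutant = 4) :
    ∃ τ : ℍ[ℝ] →⋆ₐ[ℝ] Module.End ℝ E, IsCommutantModel C τ := by
  have := hC.1
  obtain ⟨I, hI, J, hJ, hIs, hJs, hII, hJJ, hJI⟩ := hC.exists_quaternion_structure (by omega)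
  let B : QuaternionAlgebra.Basis (Module.End ℝ E) (-1 : ℝ) 0 (-1) :=
    { i := I
      j := J
      k := I * J
      i_mul_i := by simp [hII]
      j_mul_j := by simp [hJJ]
      i_mul_j := rfl
      j_mul_i := by simp [hJI] }
  let F : ℍ[ℝ] →ₐ[ℝ] Module.End ℝ E := B.liftHom
  have hF : ∀ q : ℍ[ℝ], F q =
      algebraMap ℝ _ q.re + q.imI • I + q.imJ • J + q.imK • (I * J) := fun q => rfl
  refine ⟨⟨F, fun q => ?_⟩, isCommutantModel_of_finrank_eq _ (fun q => ?_) ?_⟩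
  · change F (star q) = star (F q)
    rw [hF, hF]
    simp [Algebra.algebraMap_eq_smul_one, hIs, hJs, hJI]
  · change F q ∈ _
    rw [hF]
    exact add_mem (add_mem (add_mem (Subalgebra.algebraMap_mem _ _) (Subalgebra.smul_mem _ hI _))
      (Subalgebra.smul_mem _ hJ _)) (Subalgebra.smul_mem _ (mul_mem hI hJ) _)
  · rw [h, Quaternion.finrank_eq_four]

end SymmetricCliffordSystem

/-! ### Orthonormal families of intertwining maps -/

section Intertwining

variable {ι E W W' : Type*} [AddCommGroup E] [Module ℝ E] [AddCommGroup W] [Module ℝ W]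
  [AddCommGroup W'] [Module ℝ W']

/-- The linear map `f` intertwines the families of operators `P` and `Q`. -/
def Intertwines (P : ι → Module.End ℝ E) (Q : ι → Module.End ℝ W) (f : E →ₗ[ℝ] W) : Prop :=
  ∀ i, f ∘ₗ P i = Q i ∘ₗ f

variable {P : ι → Module.End ℝ E} {Q : ι → Module.End ℝ W} {Q' : ι → Module.End ℝ W'}

theorem Intertwines.apply {f : E →ₗ[ℝ] W} (hf : Intertwines P Q f) (i : ι) (v : E) :
    f (P i v) = Q i (f v) := LinearMap.congr_fun (hf i) v

theorem Intertwines.comp {g : W →ₗ[ℝ] W'} {f : E →ₗ[ℝ] W} (hg : Intertwines Q Q' g)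
    (hf : Intertwines P Q f) : Intertwines P Q' (g ∘ₗ f) := fun i => by
  rw [LinearMap.comp_assoc, hf i, ← LinearMap.comp_assoc, hg i, LinearMap.comp_assoc]

theorem Intertwines.smul {f : E →ₗ[ℝ] W} (hf : Intertwines P Q f) (c : ℝ) :
    Intertwines P Q (c • f) := fun i => by
  rw [LinearMap.smul_comp, LinearMap.comp_smul, hf i]

theorem Intertwines.word {f : E →ₗ[ℝ] W} (hf : Intertwines P Q f) (s : List ι) :
    f ∘ₗ word P s = word Q s ∘ₗ f := by
  induction s with
  | nil => simp [Module.End.one_eq_id]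
  | cons i s ih =>
    rw [word_cons, word_cons, Module.End.mul_eq_comp, Module.End.mul_eq_comp,
      ← LinearMap.comp_assoc, hf i, LinearMap.comp_assoc, ih, LinearMap.comp_assoc]

end Intertwining

namespace SymmetricCliffordSystem

variable {m : ℕ} {E V : Type*} [NormedAddCommGroup E] [InnerProductSpace ℝ E]
  [NormedAddCommGroup V] [InnerProductSpace ℝ V]

theorem mem_commutant_iff_intertwines {C : SymmetricCliffordSystem m E} {T : Module.End ℝ E} :
    T ∈ C.commutant ↔ Intertwines C.P C.P T := by
  rw [mem_commutant]
  exact forall_congr' fun i => eq_comm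

/-- The Clifford system `(-P_0, …, -P_m)`. -/
def negSystem (C : SymmetricCliffordSystem m E) : SymmetricCliffordSystem m E where
  P i := -C.P i
  symmetric i x y := by simpa using C.symmetric i x y
  anticomm := C.isCliffordFamily.neg

theorem IsIrreducible.negSystem {C : SymmetricCliffordSystem m E} (hC : C.IsIrreducible) :
    C.negSystem.IsIrreducible :=
  ⟨hC.1, fun S hS => hC.2 S fun i v hv => by
    simpa [SymmetricCliffordSystem.negSystem] using hS i v hv⟩

theorem commutant_negSystem (C : SymmetricCliffordSystem m E) :
    C.negSystem.commutant = C.commutant := by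
  ext T
  simp [mem_commutant, negSystem]

theorem fullWord_negSystem (C : SymmetricCliffordSystem m E) (hm : Even m) :
    C.negSystem.fullWord = -C.fullWord := by
  refine (word_neg C.P (List.finRange (m + 1))).trans ?_
  rw [List.length_finRange, hm.add_one.neg_one_pow, neg_one_smul]
  rfl

variable [FiniteDimensional ℝ E] {C₀ : SymmetricCliffordSystem m E}
  {C : SymmetricCliffordSystem m V}

/-- An invariant projection `p` through which no intertwining map from `E` factors satisfies a
linear relation with the full word. -/
theorem finrank_smul_add_trace_smul (C₀ : SymmetricCliffordSystem m E) {p : Module.End ℝ V}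
    (hp : p ∈ C.commutant) (hp2 : p * p = p)
    (h : ∀ f, Intertwines C₀.P C.P f → p ∘ₗ f = f → f = 0) :
    (Module.finrank ℝ E : ℝ) • p + (if Even m then LinearMap.trace ℝ E C₀.fullWord •
      (C.fullWord * p) else 0) = 0 := by
  have := finrank_smul_add_eq_zero (by omega : m + 1 ≠ 0) C₀.isCliffordFamily C.isCliffordFamily
    (fun i => (C.mem_commutant.1 hp i).symm) hp2 h
  rw [trace_word_reverse] at this
  simp only [Nat.odd_add_one, Nat.not_odd_iff_even] at this
  exact this

variable [FiniteDimensional ℝ V]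

theorem IsCommutantModel.negSystem {K : Type*} [Ring K] [StarRing K] [Algebra ℝ K]
    {τ : K →⋆ₐ[ℝ] Module.End ℝ E} (hτ : IsCommutantModel C₀ τ) :
    IsCommutantModel C₀.negSystem τ :=
  ⟨hτ.injective, by rw [commutant_negSystem]; exact hτ.mem_range⟩

theorem _root_.Intertwines.adjoint {f : E →ₗ[ℝ] V} (hf : Intertwines C₀.P C.P f) :
    Intertwines C.P C₀.P (LinearMap.adjoint f) := fun i => by
  have h := congrArg LinearMap.adjoint (hf i)
  rw [LinearMap.adjoint_comp, LinearMap.adjoint_comp, ← LinearMap.star_eq_adjoint (C₀.P i),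
    ← LinearMap.star_eq_adjoint (C.P i), C₀.star_P, C.star_P] at h
  exact h.symm

/-- In dimension `m ≡ 0 mod 4` the full word acts by opposite signs on an irreducible system and
on its negative, so there are no intertwining maps between them. -/
theorem IsIrreducible.eq_zero_of_intertwines_neg (hC : C₀.IsIrreducible) (hm : m % 4 = 0)
    {f : E →ₗ[ℝ] E} (hf : Intertwines C₀.negSystem.P C₀.P f) : f = 0 := by
  obtain ⟨δ, hδ, hw⟩ := hC.fullWord_eq hm
  have h := hf.word (List.finRange (m + 1))
  change f ∘ₗ C₀.negSystem.fullWord = C₀.fullWord ∘ₗ f at h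
  rw [fullWord_negSystem C₀ (Nat.even_iff.2 (by omega)), hw, LinearMap.comp_neg,
    LinearMap.smul_comp, LinearMap.comp_smul,
    Module.End.one_eq_id, LinearMap.comp_id, LinearMap.id_comp, neg_eq_iff_add_eq_zero,
    ← add_smul, smul_eq_zero] at h
  refine h.resolve_left fun h0 => ?_
  have : δ = 0 := by linarith
  rw [this] at hδ
  norm_num at hδ

/-- A finite family of isometric intertwining maps with pairwise orthogonal images. -/
structure IsOrthonormalFamily (C₀ : SymmetricCliffordSystem m E) (C : SymmetricCliffordSystem m V)
    {k : ℕ} (φ : Fin k → E →ₗ[ℝ] V) : Prop where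
  intertwines : ∀ i, Intertwines C₀.P C.P (φ i)
  adjoint_comp : ∀ i j, LinearMap.adjoint (φ i) ∘ₗ φ j = if i = j then LinearMap.id else 0

/-- The orthogonal projection to the span of the images of an orthonormal family. -/
def familyProj {k : ℕ} (φ : Fin k → E →ₗ[ℝ] V) : Module.End ℝ V :=
  ∑ i, φ i ∘ₗ LinearMap.adjoint (φ i)

theorem familyProj_apply {k : ℕ} (φ : Fin k → E →ₗ[ℝ] V) (v : V) :
    familyProj φ v = ∑ i, φ i (LinearMap.adjoint (φ i) v) := by
  simp [familyProj]

namespace IsOrthonormalFamily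

variable {k : ℕ} {φ : Fin k → E →ₗ[ℝ] V} (hφ : IsOrthonormalFamily C₀ C φ)
include hφ

theorem adjoint_apply (i j : Fin k) (v : E) :
    LinearMap.adjoint (φ i) (φ j v) = if i = j then v else 0 := by
  have := LinearMap.congr_fun (hφ.adjoint_comp i j) v
  rw [LinearMap.comp_apply] at this
  rw [this]
  split_ifs <;> rfl

theorem adjoint_comp_familyProj (i : Fin k) :
    LinearMap.adjoint (φ i) ∘ₗ familyProj φ = LinearMap.adjoint (φ i) := by
  ext v
  simp [familyProj_apply, hφ.adjoint_apply]

theorem familyProj_mul_self : familyProj φ * familyProj φ = familyProj φ := by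
  ext v
  have h := fun i => LinearMap.congr_fun (hφ.adjoint_comp_familyProj i) v
  simp only [LinearMap.comp_apply] at h
  rw [Module.End.mul_apply, familyProj_apply φ (familyProj φ v)]
  simp only [h]
  rw [familyProj_apply]

theorem familyProj_mem_commutant : familyProj φ ∈ C.commutant :=
  Subalgebra.sum_mem _ fun i _ =>
    mem_commutant_iff_intertwines.2 ((hφ.intertwines i).comp (hφ.intertwines i).adjoint)

theorem card_le [Nontrivial E] : k ≤ Module.finrank ℝ V := by
  obtain ⟨e, he⟩ := exists_norm_eq E zero_le_one
  have h : Orthonormal ℝ fun i => φ i e := by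
    rw [orthonormal_iff_ite]
    intro i j
    rw [← LinearMap.adjoint_inner_right, hφ.adjoint_apply]
    split_ifs
    · rw [real_inner_self_eq_norm_sq, he, one_pow]
    · rw [inner_zero_right]
  simpa using h.linearIndependent.fintype_card_le_finrank

/-- A nonzero intertwining map orthogonal to the family can be rescaled to an isometry, by Schur's
lemma, and extends the family. -/
theorem exists_extension (hC : C₀.IsIrreducible) {f : E →ₗ[ℝ] V} (hf : Intertwines C₀.P C.P f)
    (hφf : ∀ i, LinearMap.adjoint (φ i) ∘ₗ f = 0) (h0 : f ≠ 0) :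
    ∃ φ' : Fin (k + 1) → E →ₗ[ℝ] V, IsOrthonormalFamily C₀ C φ' := by
  obtain ⟨c, hc⟩ := hC.exists_eq_smul_one (T := LinearMap.adjoint f ∘ₗ f)
    (mem_commutant_iff_intertwines.2 (hf.adjoint.comp hf))
    (by rw [LinearMap.star_eq_adjoint, LinearMap.adjoint_comp, LinearMap.adjoint_adjoint])
  have hc0 : 0 < c := by
    obtain ⟨v, hv⟩ : ∃ v, f v ≠ 0 := by
      by_contra! hv
      exact h0 (LinearMap.ext hv)
    have h1 : inner ℝ (f v) (f v) = c * inner ℝ v v := by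
      rw [← LinearMap.adjoint_inner_right, ← LinearMap.comp_apply, hc, LinearMap.smul_apply,
        Module.End.one_apply, inner_smul_right]
    have h2 : 0 < inner ℝ (f v) (f v) := real_inner_self_pos.2 hv
    have h3 : 0 ≤ inner ℝ v v := real_inner_self_nonneg
    by_contra! h4
    have := mul_nonpos_of_nonpos_of_nonneg h4 h3
    linarith
  have hφf' : ∀ i, LinearMap.adjoint f ∘ₗ φ i = 0 := fun i => by
    have h := congrArg LinearMap.adjoint (hφf i)
    rwa [LinearMap.adjoint_comp, LinearMap.adjoint_adjoint, map_zero] at h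
  refine ⟨Fin.cons ((√c)⁻¹ • f) φ, ?_, ?_⟩
  · refine Fin.cases (hf.smul _) fun i => ?_
    simpa using hφ.intertwines i
  · refine Fin.cases (Fin.cases ?_ fun j => ?_) fun i => Fin.cases ?_ fun j => ?_
    · simp only [Fin.cons_zero, map_smulₛₗ, if_true, LinearMap.smul_comp, LinearMap.comp_smul,
        smul_smul, hc]
      rw [conj_trivial, ← mul_assoc, ← mul_inv, Real.mul_self_sqrt hc0.le,
        inv_mul_cancel₀ hc0.ne', one_smul, Module.End.one_eq_id]
    · simp [LinearMap.smul_comp, hφf', (Fin.succ_ne_zero j).symm]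
    · simp [LinearMap.comp_smul, hφf]
    · simp [hφ.adjoint_comp]

end IsOrthonormalFamily

theorem IsIrreducible.exists_maximal_family (hC : C₀.IsIrreducible)
    (C : SymmetricCliffordSystem m V) :
    ∃ (k : ℕ) (φ : Fin k → E →ₗ[ℝ] V), IsOrthonormalFamily C₀ C φ ∧
      ∀ f, Intertwines C₀.P C.P f → (∀ i, LinearMap.adjoint (φ i) ∘ₗ f = 0) → f = 0 := by
  have := hC.1
  let s : Set ℕ := {k | ∃ φ : Fin k → E →ₗ[ℝ] V, IsOrthonormalFamily C₀ C φ}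
  have hs : s.Nonempty := ⟨0, fun i => i.elim0, fun i => i.elim0, fun i => i.elim0⟩
  have hb : BddAbove s := ⟨Module.finrank ℝ V, fun k ⟨φ, hφ⟩ => hφ.card_le⟩
  obtain ⟨φ, hφ⟩ := Nat.sSup_mem hs hb
  refine ⟨_, φ, hφ, fun f hf hφf => ?_⟩
  by_contra h0
  have := le_csSup hb (hφ.exists_extension hC hf hφf h0)
  omega

/-- For `m` not divisible by four, a Clifford system is a multiple of any irreducible one. -/
theorem IsIrreducible.exists_complete_family (hC : C₀.IsIrreducible) (hm : m % 4 ≠ 0)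
    (C : SymmetricCliffordSystem m V) :
    ∃ (k : ℕ) (φ : Fin k → E →ₗ[ℝ] V), IsOrthonormalFamily C₀ C φ ∧ familyProj φ = 1 := by
  have := hC.1
  obtain ⟨k, φ, hφ, hmax⟩ := hC.exists_maximal_family C
  refine ⟨k, φ, hφ, ?_⟩
  have hS := hφ.familyProj_mul_self
  have key := finrank_smul_add_trace_smul C₀ (p := 1 - familyProj φ)
    (sub_mem (one_mem _) hφ.familyProj_mem_commutant)
    (by rw [mul_sub, sub_mul, sub_mul, hS]; simp) fun f hf hpf => hmax f hf fun i => by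
      rw [← hpf, ← LinearMap.comp_assoc, LinearMap.comp_sub, hφ.adjoint_comp_familyProj]
      simp [Module.End.one_eq_id]
  have h0 : (if Even m then LinearMap.trace ℝ E C₀.fullWord •
      (C.fullWord * (1 - familyProj φ)) else 0) = 0 := by
    split_ifs with he
    · rw [Nat.even_iff] at he
      rw [trace_fullWord_eq_zero (by omega), zero_smul]
    · rfl
  rw [h0, add_zero, smul_eq_zero] at key
  refine (sub_eq_zero.1 (key.resolve_left ?_)).symm
  exact_mod_cast Module.finrank_pos.ne'

/-- For `m` divisible by four, a Clifford system is a sum of copies of any irreducible one and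
of its negative. -/
theorem IsIrreducible.exists_complete_families (hC : C₀.IsIrreducible) (hm : m % 4 = 0)
    (C : SymmetricCliffordSystem m V) :
    ∃ (k l : ℕ) (φ : Fin k → E →ₗ[ℝ] V) (ψ : Fin l → E →ₗ[ℝ] V),
      IsOrthonormalFamily C₀ C φ ∧ IsOrthonormalFamily C₀.negSystem C ψ ∧
      (∀ i j, LinearMap.adjoint (φ i) ∘ₗ ψ j = 0) ∧ (∀ i j, LinearMap.adjoint (ψ i) ∘ₗ φ j = 0) ∧
      familyProj φ + familyProj ψ = 1 := by
  have := hC.1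
  obtain ⟨k, φ, hφ, hmaxφ⟩ := hC.exists_maximal_family C
  obtain ⟨l, ψ, hψ, hmaxψ⟩ := hC.negSystem.exists_maximal_family C
  have hφψ : ∀ i j, LinearMap.adjoint (φ i) ∘ₗ ψ j = 0 := fun i j =>
    hC.eq_zero_of_intertwines_neg hm ((hφ.intertwines i).adjoint.comp (hψ.intertwines j))
  have hψφ : ∀ i j, LinearMap.adjoint (ψ i) ∘ₗ φ j = 0 := fun i j => by
    have h := congrArg LinearMap.adjoint (hφψ j i)
    rwa [LinearMap.adjoint_comp, LinearMap.adjoint_adjoint, map_zero] at h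
  refine ⟨k, l, φ, ψ, hφ, hψ, hφψ, hψφ, ?_⟩
  have e1 : ∀ i, LinearMap.adjoint (φ i) ∘ₗ familyProj ψ = 0 := fun i => by
    ext v
    have h := fun j w => LinearMap.congr_fun (hφψ i j) w
    simp only [LinearMap.comp_apply, LinearMap.zero_apply] at h
    simp [familyProj_apply, h]
  have e2 : ∀ i, LinearMap.adjoint (ψ i) ∘ₗ familyProj φ = 0 := fun i => by
    ext v
    have h := fun j w => LinearMap.congr_fun (hψφ i j) w
    simp only [LinearMap.comp_apply, LinearMap.zero_apply] at h
    simp [familyProj_apply, h]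
  have e3 : familyProj φ * familyProj ψ = 0 := by
    rw [familyProj, Finset.sum_mul]
    simp [Module.End.mul_eq_comp, LinearMap.comp_assoc, e1]
  have e4 : familyProj ψ * familyProj φ = 0 := by
    rw [familyProj, Finset.sum_mul]
    simp [Module.End.mul_eq_comp, LinearMap.comp_assoc, e2]
  set p : Module.End ℝ V := 1 - (familyProj φ + familyProj ψ) with hp
  have hpC : p ∈ C.commutant := sub_mem (one_mem _)
    (add_mem hφ.familyProj_mem_commutant hψ.familyProj_mem_commutant)
  have hp2 : p * p = p := by
    have h : (familyProj φ + familyProj ψ) * (familyProj φ + familyProj ψ) =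
        familyProj φ + familyProj ψ := by
      rw [add_mul, mul_add, mul_add, e3, e4, hφ.familyProj_mul_self, hψ.familyProj_mul_self,
        add_zero, zero_add]
    rw [hp, mul_sub, sub_mul, sub_mul, h]
    simp
  have k1 := finrank_smul_add_trace_smul C₀ hpC hp2 fun f hf hpf => hmaxφ f hf fun i => by
    rw [← hpf, ← LinearMap.comp_assoc, hp, LinearMap.comp_sub, LinearMap.comp_add,
      hφ.adjoint_comp_familyProj, e1]
    simp [Module.End.one_eq_id]
  have k2 := finrank_smul_add_trace_smul C₀.negSystem hpC hp2 fun f hf hpf =>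
    hmaxψ f hf fun i => by
      rw [← hpf, ← LinearMap.comp_assoc, hp, LinearMap.comp_sub, LinearMap.comp_add,
        hψ.adjoint_comp_familyProj, e2]
      simp [Module.End.one_eq_id]
  rw [if_pos (Nat.even_iff.2 (by omega))] at k1 k2
  rw [fullWord_negSystem C₀ (Nat.even_iff.2 (by omega)), map_neg, neg_smul] at k2
  have k3 := congrArg₂ (· + ·) k1 k2
  simp only [add_zero] at k3
  rw [add_add_add_comm, add_neg_cancel, add_zero, ← add_smul, smul_eq_zero] at k3
  refine (sub_eq_zero.1 (k3.resolve_left ?_)).symm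
  have : (0 : ℝ) < Module.finrank ℝ E := by exact_mod_cast Module.finrank_pos
  positivity

end SymmetricCliffordSystem

/-! ### Matrices over the commutant -/

namespace SymmetricCliffordSystem

variable {m : ℕ} {E V : Type*} [NormedAddCommGroup E] [InnerProductSpace ℝ E]
  [NormedAddCommGroup V] [InnerProductSpace ℝ V] [FiniteDimensional ℝ E] [FiniteDimensional ℝ V]
  {C₀ : SymmetricCliffordSystem m E} {C : SymmetricCliffordSystem m V}
  {K : Type*} [Ring K] [StarRing K] [Algebra ℝ K]

/-- The endomorphism `∑ φ_i ∘ τ (M i j) ∘ φ_j*` with block matrix `(τ (M i j))` with respect to a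
family of maps `φ_i : E → V`. -/
def blockMap {k : ℕ} (φ : Fin k → E →ₗ[ℝ] V) (τ : K →⋆ₐ[ℝ] Module.End ℝ E) :
    Matrix (Fin k) (Fin k) K →ₗ[ℝ] Module.End ℝ V where
  toFun M := ∑ i, ∑ j, φ i ∘ₗ τ (M i j) ∘ₗ LinearMap.adjoint (φ j)
  map_add' M N := by
    simp only [Matrix.add_apply, map_add, LinearMap.add_comp, LinearMap.comp_add,
      Finset.sum_add_distrib]
  map_smul' c M := by
    simp only [Matrix.smul_apply, map_smul, LinearMap.smul_comp, LinearMap.comp_smul,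
      ← Finset.smul_sum, RingHom.id_apply]

variable {k : ℕ} {φ : Fin k → E →ₗ[ℝ] V} {τ : K →⋆ₐ[ℝ] Module.End ℝ E}

theorem blockMap_apply (M : Matrix (Fin k) (Fin k) K) (v : V) :
    blockMap φ τ M v = ∑ i, ∑ j, φ i (τ (M i j) (LinearMap.adjoint (φ j) v)) := by
  simp [blockMap]

theorem blockMap_one : blockMap φ τ 1 = familyProj φ := by
  ext v
  rw [blockMap_apply, familyProj_apply]
  refine Finset.sum_congr rfl fun i _ => ?_
  rw [Finset.sum_eq_single i]
  · simp
  · intro j _ hj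
    simp [Matrix.one_apply_ne hj.symm]
  · simp

theorem star_blockMap (M : Matrix (Fin k) (Fin k) K) :
    star (blockMap φ τ M) = blockMap φ τ (star M) := by
  simp only [blockMap, LinearMap.coe_mk, AddHom.coe_mk, LinearMap.star_eq_adjoint, map_sum,
    LinearMap.adjoint_comp, LinearMap.adjoint_adjoint, Matrix.star_apply, map_star]
  rw [Finset.sum_comm]
  simp only [LinearMap.comp_assoc]

namespace IsOrthonormalFamily

variable (hφ : IsOrthonormalFamily C₀ C φ)
include hφ

theorem adjoint_blockMap (M : Matrix (Fin k) (Fin k) K) (i : Fin k) (v : V) :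
    LinearMap.adjoint (φ i) (blockMap φ τ M v) =
      ∑ j, τ (M i j) (LinearMap.adjoint (φ j) v) := by
  rw [blockMap_apply, map_sum, Finset.sum_eq_single i]
  · simp [hφ.adjoint_apply]
  · intro j _ hj
    simp [hφ.adjoint_apply, hj.symm]
  · simp

theorem blockMap_mul (M N : Matrix (Fin k) (Fin k) K) :
    blockMap φ τ (M * N) = blockMap φ τ M * blockMap φ τ N := by
  ext v
  rw [Module.End.mul_apply, blockMap_apply, blockMap_apply]
  simp only [hφ.adjoint_blockMap, Matrix.mul_apply, map_sum, map_mul, LinearMap.sum_apply,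
    Module.End.mul_apply]
  exact Finset.sum_congr rfl fun i _ => Finset.sum_comm

theorem adjoint_blockMap_apply (M : Matrix (Fin k) (Fin k) K) (i j : Fin k) (v : E) :
    LinearMap.adjoint (φ i) (blockMap φ τ M (φ j v)) = τ (M i j) v := by
  rw [hφ.adjoint_blockMap, Finset.sum_eq_single j]
  · simp [hφ.adjoint_apply]
  · intro l _ hl
    simp [hφ.adjoint_apply, hl]
  · simp

theorem blockMap_injective (hτ : IsCommutantModel C₀ τ) :
    Function.Injective (blockMap φ τ) := by
  intro M N h
  ext i j
  refine hτ.injective (LinearMap.ext fun v => ?_)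
  rw [← hφ.adjoint_blockMap_apply, h, hφ.adjoint_blockMap_apply]

theorem blockMap_mem_commutant (hτ : IsCommutantModel C₀ τ) (M : Matrix (Fin k) (Fin k) K) :
    blockMap φ τ M ∈ C.commutant :=
  Subalgebra.sum_mem _ fun i _ => Subalgebra.sum_mem _ fun j _ =>
    mem_commutant_iff_intertwines.2 ((hφ.intertwines i).comp
      ((mem_commutant_iff_intertwines.1 ((hτ.mem_range _).1 ⟨_, rfl⟩)).comp
        (hφ.intertwines j).adjoint))

theorem exists_blockMap_eq (hτ : IsCommutantModel C₀ τ) {T : Module.End ℝ V}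
    (hT : T ∈ C.commutant) :
    ∃ M, blockMap φ τ M = familyProj φ * T * familyProj φ := by
  have h : ∀ i j, ∃ x, τ x = LinearMap.adjoint (φ i) ∘ₗ T ∘ₗ φ j := fun i j =>
    (hτ.mem_range _).2 (mem_commutant_iff_intertwines.2 ((hφ.intertwines i).adjoint.comp
      ((mem_commutant_iff_intertwines.1 hT).comp (hφ.intertwines j))))
  choose M hM using h
  refine ⟨Matrix.of M, LinearMap.ext fun v => ?_⟩
  simp only [blockMap_apply, Matrix.of_apply, hM, LinearMap.comp_apply, Module.End.mul_apply,
    familyProj_apply, map_sum]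
  exact Finset.sum_comm

/-- A complete orthonormal family identifies the commutant with a matrix algebra. -/
theorem exists_matrix_model (h1 : familyProj φ = 1) (hτ : IsCommutantModel C₀ τ) :
    ∃ Φ : Matrix (Fin k) (Fin k) K →⋆ₐ[ℝ] Module.End ℝ V, IsCommutantModel C Φ := by
  refine ⟨⟨AlgHom.ofLinearMap (blockMap φ τ) (blockMap_one.trans h1) hφ.blockMap_mul,
    fun M => (star_blockMap M).symm⟩, hφ.blockMap_injective hτ, fun T => ⟨?_, fun hT => ?_⟩⟩
  · rintro ⟨M, rfl⟩
    exact hφ.blockMap_mem_commutant hτ M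
  · obtain ⟨M, hM⟩ := hφ.exists_blockMap_eq hτ hT
    exact ⟨M, by rw [h1, one_mul, mul_one] at hM; exact hM⟩

end IsOrthonormalFamily

/-- Two complementary orthonormal families, modelled on systems without intertwining maps between
them, identify the commutant with a product of two matrix algebras. -/
theorem exists_matrix_prod_model {C₁ : SymmetricCliffordSystem m E} {l : ℕ}
    {ψ : Fin l → E →ₗ[ℝ] V} (hφ : IsOrthonormalFamily C₀ C φ) (hψ : IsOrthonormalFamily C₁ C ψ)
    (hφψ : ∀ i j, LinearMap.adjoint (φ i) ∘ₗ ψ j = 0)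
    (hψφ : ∀ i j, LinearMap.adjoint (ψ i) ∘ₗ φ j = 0)
    (h1 : familyProj φ + familyProj ψ = 1)
    (hom₁ : ∀ f : E →ₗ[ℝ] E, Intertwines C₁.P C₀.P f → f = 0)
    (hom₂ : ∀ f : E →ₗ[ℝ] E, Intertwines C₀.P C₁.P f → f = 0)
    (hτ₀ : IsCommutantModel C₀ τ) (hτ₁ : IsCommutantModel C₁ τ) :
    ∃ Φ : (Matrix (Fin k) (Fin k) K × Matrix (Fin l) (Fin l) K) →⋆ₐ[ℝ] Module.End ℝ V,
      IsCommutantModel C Φ := by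
  have a1 := fun i j v => LinearMap.congr_fun (hφψ i j) v
  have a2 := fun i j v => LinearMap.congr_fun (hψφ i j) v
  simp only [LinearMap.comp_apply, LinearMap.zero_apply] at a1 a2
  have m1 : ∀ M N, blockMap φ τ M * blockMap ψ τ N = 0 := fun M N => by
    ext v
    rw [Module.End.mul_apply, blockMap_apply, blockMap_apply]
    simp [a1]
  have m2 : ∀ M N, blockMap ψ τ M * blockMap φ τ N = 0 := fun M N => by
    ext v
    rw [Module.End.mul_apply, blockMap_apply, blockMap_apply]
    simp [a2]
  have c1 : ∀ T ∈ C.commutant, familyProj φ * T * familyProj ψ = 0 := fun T hT => by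
    have h := fun i j v => LinearMap.congr_fun (hom₁ _ ((hφ.intertwines i).adjoint.comp
      ((mem_commutant_iff_intertwines.1 hT).comp (hψ.intertwines j)))) v
    simp only [LinearMap.comp_apply, LinearMap.zero_apply] at h
    ext v
    simp [familyProj_apply, h]
  have c2 : ∀ T ∈ C.commutant, familyProj ψ * T * familyProj φ = 0 := fun T hT => by
    have h := fun i j v => LinearMap.congr_fun (hom₂ _ ((hψ.intertwines i).adjoint.comp
      ((mem_commutant_iff_intertwines.1 hT).comp (hφ.intertwines j)))) v
    simp only [LinearMap.comp_apply, LinearMap.zero_apply] at h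
    ext v
    simp [familyProj_apply, h]
  let F : (Matrix (Fin k) (Fin k) K × Matrix (Fin l) (Fin l) K) →ₗ[ℝ] Module.End ℝ V :=
    (blockMap φ τ).coprod (blockMap ψ τ)
  have hF : ∀ M, F M = blockMap φ τ M.1 + blockMap ψ τ M.2 := fun M => rfl
  have hmul : ∀ M N, F (M * N) = F M * F N := fun M N => by
    rw [hF, hF, hF, add_mul, mul_add, mul_add, m1, m2, Prod.fst_mul, Prod.snd_mul,
      hφ.blockMap_mul, hψ.blockMap_mul, add_zero, zero_add]
  have hstar : ∀ M, F (star M) = star (F M) := fun M => by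
    rw [hF, hF, star_add, star_blockMap, star_blockMap, Prod.fst_star, Prod.snd_star]
  have hinj : Function.Injective F := by
    rintro ⟨M, M'⟩ ⟨N, N'⟩ h
    rw [hF, hF] at h
    have hl : blockMap φ τ M = blockMap φ τ N := by
      have h' := congrArg (fun T => blockMap φ τ 1 * T) h
      simpa only [mul_add, m1, ← hφ.blockMap_mul, add_zero, one_mul] using h'
    have hr : blockMap ψ τ M' = blockMap ψ τ N' := by
      have h' := congrArg (fun T => blockMap ψ τ 1 * T) h
      simpa only [mul_add, m2, ← hψ.blockMap_mul, zero_add, one_mul] using h'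
    rw [hφ.blockMap_injective hτ₀ hl, hψ.blockMap_injective hτ₁ hr]
  refine ⟨⟨AlgHom.ofLinearMap F (by rw [hF]; simpa [blockMap_one] using h1) hmul, hstar⟩, hinj,
    fun T => ⟨?_, fun hT => ?_⟩⟩
  · rintro ⟨M, rfl⟩
    exact add_mem (hφ.blockMap_mem_commutant hτ₀ M.1) (hψ.blockMap_mem_commutant hτ₁ M.2)
  · obtain ⟨M, hM⟩ := hφ.exists_blockMap_eq hτ₀ hT
    obtain ⟨N, hN⟩ := hψ.exists_blockMap_eq hτ₁ hT
    refine ⟨(M, N), (hF (M, N)).trans ?_⟩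
    calc blockMap φ τ M + blockMap ψ τ N
        = (familyProj φ + familyProj ψ) * T * (familyProj φ + familyProj ψ) := by
          rw [add_mul, add_mul, mul_add, mul_add, c1 T hT, c2 T hT, hM, hN, add_zero, zero_add]
      _ = T := by rw [h1, one_mul, mul_one]

end SymmetricCliffordSystem

/-! ### The group `U⁺` as a unitary group -/

/-- The unitary group of a product of `*`-rings. -/
def unitaryProdEquiv (R S : Type*) [Monoid R] [StarMul R] [Monoid S] [StarMul S]
    [TopologicalSpace R] [TopologicalSpace S] :
    unitary (R × S) ≃ₜ* unitary R × unitary S where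
  toFun x := (⟨x.1.1, by
      have h := Unitary.mem_iff.1 x.2
      exact Unitary.mem_iff.2 ⟨congrArg Prod.fst h.1, congrArg Prod.fst h.2⟩⟩,
    ⟨x.1.2, by
      have h := Unitary.mem_iff.1 x.2
      exact Unitary.mem_iff.2 ⟨congrArg Prod.snd h.1, congrArg Prod.snd h.2⟩⟩)
  invFun y := ⟨(y.1, y.2), by
    have h1 := Unitary.mem_iff.1 y.1.2
    have h2 := Unitary.mem_iff.1 y.2.2
    exact Unitary.mem_iff.2 ⟨Prod.ext h1.1 h2.1, Prod.ext h1.2 h2.2⟩⟩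
  left_inv x := rfl
  right_inv y := rfl
  map_mul' x y := rfl
  continuous_toFun := by fun_prop
  continuous_invFun := by fun_prop

namespace SymmetricCliffordSystem

variable {m : ℕ} {V : Type*} [NormedAddCommGroup V] [InnerProductSpace ℝ V]
  [CompleteSpace V] {C : SymmetricCliffordSystem m V}

theorem mem_uPlus {U : unitary (V →L[ℝ] V)} :
    U ∈ C.uPlus ↔ ((U : V →L[ℝ] V) : V →ₗ[ℝ] V) ∈ C.commutant := by
  constructor
  · intro h
    exact C.mem_commutant.2 fun i => LinearMap.ext fun v =>
      h (C.P i) (Submodule.subset_span ⟨i, rfl⟩) v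
  · intro h T hT v
    induction hT using Submodule.span_induction with
    | mem T hT =>
      obtain ⟨i, rfl⟩ := hT
      exact LinearMap.congr_fun (C.mem_commutant.1 h i) v
    | zero => simp
    | add S T _ _ hS hT => simp [hS, hT]
    | smul c T _ hT => simp [hT]

variable [FiniteDimensional ℝ V]

/-- A `*`-isomorphism of a finite-dimensional `*`-algebra onto the commutant restricts to an
isomorphism of unitary groups, which is a homeomorphism because injective linear maps between
finite-dimensional spaces are closed embeddings. -/
theorem IsCommutantModel.nonempty_uPlus_equiv {R : Type*} [Ring R] [StarRing R] [Algebra ℝ R]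
    [Module.Finite ℝ R] [TopologicalSpace R] [T2Space R] [IsTopologicalAddGroup R]
    [ContinuousSMul ℝ R] {Φ : R →⋆ₐ[ℝ] Module.End ℝ V} (hΦ : IsCommutantModel C Φ) :
    Nonempty (C.uPlus ≃ₜ* unitary R) := by
  let Ψ : R →⋆ₐ[ℝ] (V →L[ℝ] V) :=
    ⟨(Module.End.toContinuousLinearMap V).toAlgHom.comp Φ.toAlgHom, fun x => by
      change LinearMap.toContinuousLinearMap (Φ (star x)) =
        star (LinearMap.toContinuousLinearMap (Φ x))
      rw [map_star, LinearMap.star_eq_adjoint, LinearMap.adjoint_toContinuousLinearMap]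
      rfl⟩
  have hΨ : ∀ x, ((Ψ x : V →L[ℝ] V) : V →ₗ[ℝ] V) = Φ x := fun x => rfl
  have hinj : Function.Injective Ψ := fun x y h => hΦ.injective (by rw [← hΨ, h, hΨ])
  have hind : Topology.IsInducing Ψ :=
    (LinearMap.isClosedEmbedding_of_injective (f := Ψ.toAlgHom.toLinearMap)
      (LinearMap.ker_eq_bot.2 hinj)).isInducing
  let F : unitary R →* C.uPlus :=
    (Unitary.map
      (⟨(Ψ : R →* (V →L[ℝ] V)), map_star Ψ⟩ : R →⋆* (V →L[ℝ] V))).toMonoidHom.codRestrict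
        C.uPlus fun x => mem_uPlus.2 ((hΦ.mem_range _).1 ⟨x, rfl⟩)
  have hF : ∀ x, ((F x : unitary (V →L[ℝ] V)) : V →L[ℝ] V) = Ψ x := fun x => rfl
  have hbij : Function.Bijective F := by
    refine ⟨fun x y h => Subtype.ext (hinj ?_), fun U => ?_⟩
    · rw [← hF, h, hF]
    · obtain ⟨x, hx⟩ := (hΦ.mem_range _).2 (mem_uPlus.1 U.2)
      have hx' : Ψ x = U.1.1 := by
        ext v
        exact LinearMap.congr_fun hx v
      have hU := Unitary.mem_iff.1 U.1.2
      refine ⟨⟨x, Unitary.mem_iff.2 ⟨hinj ?_, hinj ?_⟩⟩, Subtype.ext (Subtype.ext hx')⟩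
      · rw [map_mul, map_star, hx', map_one, hU.1]
      · rw [map_mul, map_star, hx', map_one, hU.2]
  have hFind : Topology.IsInducing F := by
    have h : Topology.IsInducing
        (fun U : C.uPlus => ((U : unitary (V →L[ℝ] V)) : V →L[ℝ] V)) :=
      Topology.IsInducing.subtypeVal.comp Topology.IsInducing.subtypeVal
    exact h.of_comp_iff.1 (hind.comp Topology.IsInducing.subtypeVal)
  let e : unitary R ≃ₜ* C.uPlus :=
    { MulEquiv.ofBijective F hbij with
      continuous_toFun := hFind.continuous
      continuous_invFun := ((Equiv.ofBijective F hbij).toHomeomorphOfIsInducing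
        hFind).symm.continuous }
  exact ⟨e.symm⟩

end SymmetricCliffordSystem

/-! ### Representations of the Clifford algebra and their generators -/

section Generators

variable {m : ℕ} {W W' : Type*} [AddCommGroup W] [Module ℝ W] [AddCommGroup W'] [Module ℝ W']

/-- The generator `E_i` of the Clifford algebra. -/
def cliffordGen (m : ℕ) (i : Fin (m + 1)) : Cl m :=
  CliffordAlgebra.ι (stdForm m) (Pi.single i 1)

/-- The operators by which the generators act in a representation. -/
def repGen (χ : Cl m →ₐ[ℝ] Module.End ℝ W) (i : Fin (m + 1)) : Module.End ℝ W :=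
  χ (cliffordGen m i)

theorem ι_eq_sum_cliffordGen (x : Fin (m + 1) → ℝ) :
    CliffordAlgebra.ι (stdForm m) x = ∑ i, x i • cliffordGen m i := by
  conv_lhs => rw [← Finset.univ_sum_single x, map_sum]
  refine Finset.sum_congr rfl fun i _ => ?_
  rw [cliffordGen, ← map_smul, ← Pi.single_smul, smul_eq_mul, mul_one]

theorem isCliffordFamily_cliffordGen (m : ℕ) : IsCliffordFamily (cliffordGen m) := fun i j => by
  rw [cliffordGen, cliffordGen, CliffordAlgebra.ι_mul_ι_add_swap, Algebra.algebraMap_eq_smul_one]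
  congr 1
  have h : QuadraticMap.polar (stdForm m) (Pi.single i 1) (Pi.single j 1) =
      ∑ k, 2 * ((Pi.single i 1 : Fin (m + 1) → ℝ) k * (Pi.single j 1 : Fin (m + 1) → ℝ) k) := by
    simp only [QuadraticMap.polar, stdForm, QuadraticMap.weightedSumSquares_apply,
      ← Finset.sum_sub_distrib]
    refine Finset.sum_congr rfl fun k _ => ?_
    simp only [Pi.add_apply, smul_eq_mul]
    ring
  rw [h, ← Finset.mul_sum]
  by_cases hij : i = j
  · subst hij
    simp [Pi.single_apply]
  · simp [Pi.single_apply, hij, Ne.symm hij]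

theorem isCliffordFamily_repGen (χ : Cl m →ₐ[ℝ] Module.End ℝ W) : IsCliffordFamily (repGen χ) :=
  fun i j => by
    have h := congrArg χ (isCliffordFamily_cliffordGen m i j)
    rwa [map_add, map_mul, map_mul, map_smul, map_one] at h

theorem Intertwines.map_rep {χ : Cl m →ₐ[ℝ] Module.End ℝ W} {σ : Cl m →ₐ[ℝ] Module.End ℝ W'}
    {f : W →ₗ[ℝ] W'} (hf : Intertwines (repGen χ) (repGen σ) f) (a : Cl m) (w : W) :
    f (χ a w) = σ a (f w) := by
  induction a using CliffordAlgebra.induction generalizing w with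
  | algebraMap r => simp [AlgHom.commutes, Module.algebraMap_end_apply]
  | ι x =>
    have h := fun i v => hf.apply i v
    simp only [repGen] at h
    simp [ι_eq_sum_cliffordGen, h]
  | mul a b ha hb => simp [ha, hb]
  | add a b ha hb => simp [ha, hb]

theorem rep_mem_of_repGen_mem {χ : Cl m →ₐ[ℝ] Module.End ℝ W} {S : Submodule ℝ W}
    (hS : ∀ i, ∀ w ∈ S, repGen χ i w ∈ S) (a : Cl m) {w : W} (hw : w ∈ S) : χ a w ∈ S := by
  induction a using CliffordAlgebra.induction generalizing w with
  | algebraMap r =>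
    rw [AlgHom.commutes, Module.algebraMap_end_apply]
    exact S.smul_mem r hw
  | ι x =>
    rw [ι_eq_sum_cliffordGen, map_sum, LinearMap.sum_apply]
    refine S.sum_mem fun i _ => ?_
    rw [map_smul]
    exact S.smul_mem _ (hS i w hw)
  | mul a b ha hb =>
    rw [map_mul]
    exact ha (hb hw)
  | add a b ha hb =>
    rw [map_add]
    exact S.add_mem (ha hw) (hb hw)

theorem repGen_twistRep (χ : Cl m →ₐ[ℝ] Module.End ℝ W) (i : Fin (m + 1)) :
    repGen (twistRep χ) i = -repGen χ i := by
  simp [repGen, twistRep, cliffordGen]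

theorem SymmetricCliffordSystem.repGen_rep {V : Type*} [NormedAddCommGroup V]
    [InnerProductSpace ℝ V] (C : SymmetricCliffordSystem m V) : repGen C.rep = C.P :=
  funext C.rep_ι_single

theorem IsIrreducibleRep.twistRep {χ : Cl m →ₐ[ℝ] Module.End ℝ W} (hχ : IsIrreducibleRep χ) :
    IsIrreducibleRep (twistRep χ) := by
  refine ⟨hχ.1, fun S hS => hχ.2 S fun a w hw => rep_mem_of_repGen_mem (fun i v hv => ?_) a hw⟩
  have h := hS (cliffordGen m i) v hv
  change repGen (_root_.twistRep χ) i v ∈ S at h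
  rw [repGen_twistRep] at h
  simpa using S.neg_mem h

/-- Schur's lemma: a nonzero intertwining map between irreducible families is bijective. -/
theorem IsIrreducibleRep.bijective_of_intertwines {E : Type*} [NormedAddCommGroup E]
    [InnerProductSpace ℝ E] {C₀ : SymmetricCliffordSystem m E} (hC : C₀.IsIrreducible)
    {χ : Cl m →ₐ[ℝ] Module.End ℝ W} (hχ : IsIrreducibleRep χ) {f : E →ₗ[ℝ] W}
    (hf : Intertwines C₀.P (repGen χ) f) (h0 : f ≠ 0) : Function.Bijective f := by
  constructor
  · refine LinearMap.ker_eq_bot.1 ((hC.2 (LinearMap.ker f) fun i v hv => ?_).resolve_right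
      fun h => h0 (LinearMap.ker_eq_top.1 h))
    rw [LinearMap.mem_ker] at hv ⊢
    rw [hf.apply, hv, map_zero]
  · refine LinearMap.range_eq_top.1 ((hχ.2 (LinearMap.range f) fun a w hw =>
      rep_mem_of_repGen_mem ?_ a hw).resolve_left fun h => h0 (LinearMap.range_eq_bot.1 h))
    rintro i _ ⟨v, rfl⟩
    exact ⟨C₀.P i v, hf.apply i v⟩

end Generators

namespace SymmetricCliffordSystem

variable {m : ℕ} {V : Type*} [NormedAddCommGroup V] [InnerProductSpace ℝ V]

/-- The restriction of a Clifford system to an invariant subspace. -/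
def restrict (C : SymmetricCliffordSystem m V) (S : Submodule ℝ V)
    (hS : ∀ i, ∀ v ∈ S, C.P i v ∈ S) : SymmetricCliffordSystem m S where
  P i := (C.P i).restrict (hS i)
  symmetric i x y := C.symmetric i x y
  anticomm i j := by
    ext v
    have h := LinearMap.congr_fun (C.anticomm i j) (v : V)
    split_ifs at h ⊢ <;> simpa using h

theorem exists_irreducible_restrict [FiniteDimensional ℝ V] [Nontrivial V]
    (C : SymmetricCliffordSystem m V) :
    ∃ (S : Submodule ℝ V) (C₀ : SymmetricCliffordSystem m S), C₀.IsIrreducible := by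
  obtain ⟨S, ⟨hS0, hS⟩, hmin⟩ := WellFounded.has_min
    (wellFounded_lt : WellFounded ((· < ·) : Submodule ℝ V → Submodule ℝ V → Prop))
    {S | S ≠ ⊥ ∧ ∀ i, ∀ v ∈ S, C.P i v ∈ S} ⟨⊤, top_ne_bot, fun _ _ _ => Submodule.mem_top⟩
  refine ⟨S, C.restrict S hS, (Submodule.nontrivial_iff_ne_bot).2 hS0, fun T hT => ?_⟩
  by_contra! hT'
  refine hmin (T.map S.subtype) ⟨?_, ?_⟩ (lt_of_le_of_ne (Submodule.map_subtype_le S T) ?_)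
  · intro h
    refine hT'.1 (Submodule.map_injective_of_injective S.subtype_injective ?_)
    rw [h, Submodule.map_bot]
  · rintro i _ ⟨v, hv, rfl⟩
    exact ⟨_, hT i v hv, rfl⟩
  · intro h
    refine hT'.2 (Submodule.map_injective_of_injective S.subtype_injective ?_)
    rw [h, Submodule.map_top, Submodule.range_subtype]

/-- Every irreducible representation is equivalent to a Clifford system on a Euclidean space: an
irreducible part of `V` or its negative. -/
theorem exists_euclidean_model [FiniteDimensional ℝ V] [Nontrivial V]
    (C : SymmetricCliffordSystem m V) {D : Type*} [AddCommGroup D] [Module ℝ D]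
    {χ : Cl m →ₐ[ℝ] Module.End ℝ D} (hχ : IsIrreducibleRep χ) :
    ∃ (S : Submodule ℝ V) (C₀ : SymmetricCliffordSystem m S) (e : S ≃ₗ[ℝ] D),
      C₀.IsIrreducible ∧ Intertwines C₀.P (repGen χ) e := by
  obtain ⟨S, C₀, hC⟩ := C.exists_irreducible_restrict
  have := hC.1
  have := hχ.1
  suffices h : ∃ C₁ : SymmetricCliffordSystem m S, C₁.IsIrreducible ∧
      ∃ f : S →ₗ[ℝ] D, Intertwines C₁.P (repGen χ) f ∧ f ≠ 0 by
    obtain ⟨C₁, hC₁, f, hf, h0⟩ := h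
    exact ⟨S, C₁, LinearEquiv.ofBijective f (hχ.bijective_of_intertwines hC₁ hf h0), hC₁, hf⟩
  by_contra! hno
  have key : ∀ C₁ : SymmetricCliffordSystem m S, C₁.IsIrreducible →
      (Module.finrank ℝ S : ℝ) • (1 : Module.End ℝ D) +
      (if Even m then LinearMap.trace ℝ S C₁.fullWord • word (repGen χ) (List.finRange (m + 1))
        else 0) = 0 := fun C₁ hC₁ => by
    have h := finrank_smul_add_eq_zero (by omega : m + 1 ≠ 0) C₁.isCliffordFamily
      (isCliffordFamily_repGen χ) (p := 1) (fun i => by rw [one_mul, mul_one]) (one_mul 1)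
      fun f hf _ => hno C₁ hC₁ f hf
    rw [trace_word_reverse, mul_one] at h
    simp only [Nat.odd_add_one, Nat.not_odd_iff_even] at h
    exact h
  -- The relations for `C₀` and its negative differ by the sign of the term with the full word.
  have k1 := key C₀ hC
  have k2 := key _ hC.negSystem
  have hpos : (0 : ℝ) < Module.finrank ℝ S := by exact_mod_cast Module.finrank_pos
  have k3 : (Module.finrank ℝ S : ℝ) • (1 : Module.End ℝ D) +
      (Module.finrank ℝ S : ℝ) • (1 : Module.End ℝ D) = 0 := by
    by_cases he : Even m
    · rw [if_pos he] at k1 k2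
      rw [C₀.fullWord_negSystem he, map_neg, neg_smul] at k2
      have k3 := congrArg₂ (· + ·) k1 k2
      simp only [add_zero] at k3
      rwa [add_add_add_comm, add_neg_cancel, add_zero] at k3
    · rw [if_neg he, add_zero] at k1
      rw [k1, add_zero]
  rw [← add_smul, smul_eq_zero] at k3
  rcases k3 with h | h
  · linarith
  · exact one_ne_zero h

section Equivalence

variable {E D : Type*} [NormedAddCommGroup E] [InnerProductSpace ℝ E] [FiniteDimensional ℝ E]
  [FiniteDimensional ℝ V] [AddCommGroup D] [Module ℝ D]
  {C₀ : SymmetricCliffordSystem m E} {C : SymmetricCliffordSystem m V}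
  {χ : Cl m →ₐ[ℝ] Module.End ℝ D} {k l : ℕ} {φ : Fin k → E →ₗ[ℝ] V} {ψ : Fin l → E →ₗ[ℝ] V}

theorem IsOrthonormalFamily.adjoint_rep (hφ : IsOrthonormalFamily C₀ C φ) {e : E ≃ₗ[ℝ] D}
    (he : Intertwines C₀.P (repGen χ) e) (a : Cl m) (i : Fin k) (v : V) :
    e (LinearMap.adjoint (φ i) (C.rep a v)) = χ a (e (LinearMap.adjoint (φ i) v)) := by
  have h : Intertwines (repGen C.rep) (repGen χ) (e ∘ₗ LinearMap.adjoint (φ i)) := by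
    rw [repGen_rep]
    exact he.comp (hφ.intertwines i).adjoint
  exact h.map_rep a v

theorem IsOrthonormalFamily.equivalentRep_copiesRep (hφ : IsOrthonormalFamily C₀ C φ)
    (h1 : familyProj φ = 1) {e : E ≃ₗ[ℝ] D} (he : Intertwines C₀.P (repGen χ) e) :
    EquivalentRep C.rep (copiesRep χ k) := by
  refine ⟨LinearEquiv.ofLinearMap
    (LinearMap.pi fun i => (e : E →ₗ[ℝ] D) ∘ₗ LinearMap.adjoint (φ i))
    (∑ i, φ i ∘ₗ (e.symm : D →ₗ[ℝ] E) ∘ₗ LinearMap.proj i) ?_ ?_, fun a v => ?_⟩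
  · refine LinearMap.ext fun w => funext fun i => ?_
    simp [hφ.adjoint_apply, apply_ite e]
  · refine LinearMap.ext fun v => ?_
    have := LinearMap.congr_fun h1 v
    rw [familyProj_apply] at this
    simpa using this
  · funext i
    exact hφ.adjoint_rep he a i v

theorem equivalentRep_sumRep (hφ : IsOrthonormalFamily C₀ C φ)
    (hψ : IsOrthonormalFamily C₀.negSystem C ψ)
    (hφψ : ∀ i j, LinearMap.adjoint (φ i) ∘ₗ ψ j = 0)
    (hψφ : ∀ i j, LinearMap.adjoint (ψ i) ∘ₗ φ j = 0)
    (h1 : familyProj φ + familyProj ψ = 1) {e : E ≃ₗ[ℝ] D}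
    (he : Intertwines C₀.P (repGen χ) e) :
    EquivalentRep C.rep (sumRep (copiesRep χ k) (copiesRep (twistRep χ) l)) := by
  have a1 := fun i j v => LinearMap.congr_fun (hφψ i j) v
  have a2 := fun i j v => LinearMap.congr_fun (hψφ i j) v
  simp only [LinearMap.comp_apply, LinearMap.zero_apply] at a1 a2
  have he' : Intertwines C₀.negSystem.P (repGen (twistRep χ)) e := fun i => by
    rw [repGen_twistRep]
    change (e : E →ₗ[ℝ] D) ∘ₗ (-C₀.P i) = _
    rw [LinearMap.comp_neg, he i]
    rfl
  refine ⟨LinearEquiv.ofLinearMap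
    ((LinearMap.pi fun i => (e : E →ₗ[ℝ] D) ∘ₗ LinearMap.adjoint (φ i)).prod
      (LinearMap.pi fun i => (e : E →ₗ[ℝ] D) ∘ₗ LinearMap.adjoint (ψ i)))
    ((∑ i, φ i ∘ₗ (e.symm : D →ₗ[ℝ] E) ∘ₗ LinearMap.proj i).coprod
      (∑ i, ψ i ∘ₗ (e.symm : D →ₗ[ℝ] E) ∘ₗ LinearMap.proj i)) ?_ ?_, fun a v => ?_⟩
  · refine LinearMap.ext fun w => Prod.ext (funext fun i => ?_) (funext fun i => ?_)
    · simp [hφ.adjoint_apply, a1, apply_ite e]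
    · simp [hψ.adjoint_apply, a2, apply_ite e]
  · refine LinearMap.ext fun v => ?_
    have := LinearMap.congr_fun h1 v
    rw [LinearMap.add_apply, familyProj_apply, familyProj_apply] at this
    simpa using this
  · exact Prod.ext (funext fun i => hφ.adjoint_rep he a i v)
      (funext fun i => hψ.adjoint_rep he' a i v)

end Equivalence

end SymmetricCliffordSystem

end

theorem mainTheorem7 {m : ℕ} {V : Type*} [NormedAddCommGroup V] [InnerProductSpace ℝ V]
    [FiniteDimensional ℝ V] [CompleteSpace V] [Nontrivial V]
    (C : SymmetricCliffordSystem m V)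
    {D : Type*} [AddCommGroup D] [Module ℝ D]
    (χ : Cl m →ₐ[ℝ] Module.End ℝ D) (hχ : IsIrreducibleRep χ) :
    (m % 4 ≠ 0 →
      ∃ k : ℕ, 0 < k ∧ EquivalentRep C.rep (copiesRep χ k) ∧
        (m % 8 = 1 ∨ m % 8 = 7 → Nonempty (C.uPlus ≃ₜ* OrthGroup k)) ∧
        (m % 8 = 2 ∨ m % 8 = 6 → Nonempty (C.uPlus ≃ₜ* UnitGroup k)) ∧
        (m % 8 = 3 ∨ m % 8 = 5 → Nonempty (C.uPlus ≃ₜ* SpGroup k))) ∧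
    (m % 4 = 0 →
      IsIrreducibleRep (twistRep χ) ∧ ¬ EquivalentRep χ (twistRep χ) ∧
      ∃ kp km : ℕ, 0 < kp + km ∧
        EquivalentRep C.rep (sumRep (copiesRep χ kp) (copiesRep (twistRep χ) km)) ∧
        (m % 8 = 0 → Nonempty (C.uPlus ≃ₜ* (OrthGroup kp × OrthGroup km))) ∧
        (m % 8 = 4 → Nonempty (C.uPlus ≃ₜ* (SpGroup kp × SpGroup km)))) := by
  obtain ⟨S, C₀, e, hC, he⟩ := C.exists_euclidean_model hχ
  obtain ⟨hR, hI, hQ⟩ := hC.finrank_commutant_eq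
  have := hC.1
  refine ⟨fun hm => ?_, fun hm => ⟨hχ.twistRep, ?_, ?_⟩⟩
  · obtain ⟨k, φ, hφ, h1⟩ := hC.exists_complete_family hm C
    refine ⟨k, Nat.pos_of_ne_zero ?_, hφ.equivalentRep_copiesRep h1 he, fun h => ?_, fun h => ?_,
      fun h => ?_⟩
    · rintro rfl
      exact zero_ne_one (α := Module.End ℝ V) (by
        simp [← h1, SymmetricCliffordSystem.familyProj])
    · obtain ⟨τ, hτ⟩ := hC.exists_real_model (hR (Or.inr h))
      obtain ⟨Φ, hΦ⟩ := hφ.exists_matrix_model h1 hτ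
      exact hΦ.nonempty_uPlus_equiv
    · obtain ⟨τ, hτ⟩ := hC.exists_complex_model (hI h)
      obtain ⟨Φ, hΦ⟩ := hφ.exists_matrix_model h1 hτ
      exact hΦ.nonempty_uPlus_equiv
    · obtain ⟨τ, hτ⟩ := hC.exists_quaternion_model (hQ (by omega))
      obtain ⟨Φ, hΦ⟩ := hφ.exists_matrix_model h1 hτ
      exact hΦ.nonempty_uPlus_equiv
  · rintro ⟨e', he'⟩
    have hf : Intertwines C₀.negSystem.P C₀.P
        ((e.symm : D →ₗ[ℝ] S) ∘ₗ (e' : D →ₗ[ℝ] D) ∘ₗ (e : S →ₗ[ℝ] D)) := fun i => by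
      refine LinearMap.ext fun v => e.injective ?_
      have h1 : ∀ v, e (C₀.P i v) = repGen χ i (e v) := he.apply i
      have h2 : ∀ w, e' (repGen χ i w) = -repGen χ i (e' w) := fun w => by
        have := he' (cliffordGen m i) w
        change _ = repGen (twistRep χ) i (e' w) at this
        rw [repGen_twistRep] at this
        exact this
      simp [SymmetricCliffordSystem.negSystem, h1, h2]
    have h0 := hC.eq_zero_of_intertwines_neg hm hf
    obtain ⟨v, hv⟩ := exists_ne (0 : S)
    have := LinearMap.congr_fun h0 v
    simp [hv] at this
  · obtain ⟨k, l, φ, ψ, hφ, hψ, hφψ, hψφ, h1⟩ := hC.exists_complete_families hm C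
    have hom₁ : ∀ f : S →ₗ[ℝ] S, Intertwines C₀.negSystem.P C₀.P f → f = 0 := fun f hf =>
      hC.eq_zero_of_intertwines_neg hm hf
    have hom₂ : ∀ f : S →ₗ[ℝ] S, Intertwines C₀.P C₀.negSystem.P f → f = 0 := fun f hf =>
      hom₁ f fun i => by
        have := hf i
        simp only [SymmetricCliffordSystem.negSystem, LinearMap.comp_neg,
          LinearMap.neg_comp] at this ⊢
        rw [this, neg_neg]
    refine ⟨k, l, Nat.pos_of_ne_zero fun h => ?_,
      SymmetricCliffordSystem.equivalentRep_sumRep hφ hψ hφψ hψφ h1 he, fun h => ?_, fun h => ?_⟩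
    · obtain ⟨rfl, rfl⟩ := Nat.add_eq_zero_iff.1 h
      exact zero_ne_one (α := Module.End ℝ V) (by
        simp [← h1, SymmetricCliffordSystem.familyProj])
    · obtain ⟨τ, hτ⟩ := hC.exists_real_model (hR (Or.inl h))
      obtain ⟨Φ, hΦ⟩ := SymmetricCliffordSystem.exists_matrix_prod_model hφ hψ hφψ hψφ h1
        hom₁ hom₂ hτ hτ.negSystem
      obtain ⟨ε⟩ := hΦ.nonempty_uPlus_equiv
      exact ⟨ε.trans (unitaryProdEquiv _ _)⟩
    · obtain ⟨τ, hτ⟩ := hC.exists_quaternion_model (hQ (by omega))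
      obtain ⟨Φ, hΦ⟩ := SymmetricCliffordSystem.exists_matrix_prod_model hφ hψ hφψ hψφ h1
        hom₁ hom₂ hτ hτ.negSystem
      obtain ⟨ε⟩ := hΦ.nonempty_uPlus_equiv
      exact ⟨ε.trans (unitaryProdEquiv _ _)⟩
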